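/- **Theorem 2.1.** Let $n\in\mathbb N$, $\alpha>0$, $\langle z,w\rangle=\sum_{j=1}^n z_j\overline{w_j}$ and $|z|^2=\langle z,z\rangle$ on $\mathbb C^n$. For $1\le p<\infty$ let $\mathcal F^p_\alpha$ be the space of entire functions $f$ on $\mathbb C^n$ with $$\|f\|_{(p,\alpha)}^p=\Big(\frac{\alpha p}{2\pi}\Big)^n\int_{\mathbb C^n}|f(z)|^pe^{-\frac{\alpha p}{2}|z|^2}\,dV(z)<\infty,$$ where $V$ is Lebesgue measure, and let $\mathcal F^\infty_\alpha$ be the space of entire functions with $\|f\|_{(\infty,\alpha)}=\sup_{z}|f(z)|e^{-\frac{\alpha}{2}|z|^2}<\infty$. Let $K_w(z)=e^{\alpha\langle z,w\rangle}$. A nonnegative Borel measure $\mu$ on $\mathbb C^n$ is called *admissible* if $\int|K_w(z)|^2e^{-\alpha|w|^2}\,d\mu(w)<\infty$ for every $z\in\mathbb C^n$. The Toeplitz operator $$T_\mu f(z)=\int_{\mathbb C^n}K_w(z)f(w)e^{-\alpha|w|^2}\,d\mu(w)$$ is then densely defined on $\mathcal F^p_\alpha$, with domain the set of those $f\in\mathcal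 F^p_\alpha$ for which the integral converges absolutely for every $z$. It is called bounded (respectively compact) from $\mathcal F^p_\alpha$ to $\mathcal F^\infty_\alpha$ if it extends to a bounded (respectively compact) linear operator $\mathcal F^p_\alpha\to\mathcal F^\infty_\alpha$; the norm of this extension is denoted $\|T_\mu\|$. For $1\le q<\infty$ put $d\sigma_q(z)=e^{-\frac{q\alpha}{2}|z|^2}\,d\mu(z)$. The measure $\mu$ is a $(1,q)$ *Fock–Carleson measure* if there is a constant $C$ with $\int|f|^q\,d\sigma_q\le C\|f\|_{(1,\alpha)}^q$ for all $f\in\mathcal F^1_\alpha$, and a $(1,q)$ *vanishing Fock–Carleson measure* if the embedding $\mathcal F^1_\alpha\to L^q(\sigma_q)$, $f\mapsto f$, is a compact operator. Let $1\le p<\infty$. For every admissible $\mu$: (i) The following are equivalent: $T_\mu:\mathcal F^p_\alpha\to\mathcal F^\infty_\alpha$ is bounded; $\mu$ is a $(1,q)$ Fock–Carleson measure for some finite $q\ge p$; $\mu$ is a $(1,q)$ Fock–Carleson measure for every finite $q\ge p$. In this case the domain of $T_\mu$ is all of $\mathcal F^p_\alpha$. (ii) The following are equivalent: $T_\mu:\mathcal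 F^p_\alpha\to\mathcal F^\infty_\alpha$ is compact; $\mu$ is a $(1,q)$ vanishing Fock–Carleson measure for some finite $q\ge p$; $\mu$ is a $(1,q)$ vanishing Fock–Carleson measure for every finite $q\ge p$. Moreover, $\|T_\mu\|\simeq\|I_\mu\|$, where $I_\mu:\mathcal F^1_\alpha\to L^1(\sigma_1)$ is the embedding $f\mapsto f$: there is a constant $C>0$ depending only on $n,\alpha,p$ such that for every admissible $\mu$, $T_\mu:\mathcal F^p_\alpha\to\mathcal F^\infty_\alpha$ is bounded if and only if $I_\mu$ is bounded, and in that case $\|T_\mu\|\le C\|I_\mu\|$ and $\|I_\mu\|\le C\|T_\mu\|$. -/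

import Mathlib

open MeasureTheory
open scoped NNReal ENNReal

noncomputable section

/-- The space `ℂⁿ` with its Hermitian inner product and norm `|z|`; its `volume` is Lebesgue measure. -/
abbrev CSpace (n : ℕ) : Type := EuclideanSpace ℂ (Fin n)

instance fact_one_le_coe_nnreal (p : ℝ≥0) [h : Fact (1 ≤ p)] : Fact (1 ≤ (p : ℝ≥0∞)) :=
  ⟨by exact_mod_cast h.out⟩

instance fact_one_le_one_nnreal : Fact ((1 : ℝ≥0) ≤ 1) := ⟨le_rfl⟩

namespace Fock

variable {n : ℕ} {α : ℝ} {p : ℝ≥0}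

/-- The function `z ↦ f(z) e^{-α|z|²/2}`. -/
def weighted (α : ℝ) (f : CSpace n → ℂ) (z : CSpace n) : ℂ :=
  f z * (Real.exp (-(α / 2) * ‖z‖ ^ 2) : ℂ)

theorem weighted_add (f g : CSpace n → ℂ) : weighted α (f + g) = weighted α f + weighted α g := by
  funext z; simp [weighted, add_mul]

theorem weighted_smul (c : ℂ) (f : CSpace n → ℂ) : weighted α (c • f) = c • weighted α f := by
  funext z; simp [weighted, mul_assoc]

theorem weighted_zero : weighted α (0 : CSpace n → ℂ) = 0 := by
  funext z; simp [weighted]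

theorem norm_weighted (f : CSpace n → ℂ) (z : CSpace n) :
    ‖weighted α f z‖ = ‖f z‖ * Real.exp (-(α / 2) * ‖z‖ ^ 2) := by
  rw [weighted, norm_mul, Complex.norm_real, Real.norm_of_nonneg (Real.exp_pos _).le]

theorem weighted_injective : Function.Injective (weighted (n := n) α) := by
  intro f g h
  funext z
  have hz := congrFun h z
  have hne : (Real.exp (-(α / 2) * ‖z‖ ^ 2) : ℂ) ≠ 0 := by
    exact_mod_cast (Real.exp_pos _).ne'
  exact mul_right_cancel₀ hne hz

theorem continuous_weighted {f : CSpace n → ℂ} (hf : Continuous f) :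
    Continuous (weighted α f) := by
  unfold weighted; fun_prop

/-- The normalized Lebesgue measure `(αp/2π)ⁿ dV` on `ℂⁿ`. -/
def normalizedVolume (n : ℕ) (α : ℝ) (p : ℝ≥0) : Measure (CSpace n) :=
  ENNReal.ofReal ((α * p / (2 * Real.pi)) ^ n) • volume

theorem mass_pos [hα : Fact (0 < α)] [hp : Fact (1 ≤ p)] :
    0 < (α * p / (2 * Real.pi)) ^ n := by
  have h1 : (0 : ℝ) < α := hα.out
  have h2 : (0 : ℝ) < p := by exact_mod_cast lt_of_lt_of_le one_pos hp.out
  have := Real.pi_pos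
  positivity

/-- The vector space of entire functions `f` on `ℂⁿ` such that `|f|^p e^{-αp|z|²/2}` is Lebesgue
integrable, as a subspace of all functions. -/
def fockSubmodule (n : ℕ) (α : ℝ) (p : ℝ≥0) : Submodule ℂ (CSpace n → ℂ) where
  carrier := {f | Differentiable ℂ f ∧ MemLp (weighted α f) p (normalizedVolume n α p)}
  add_mem' := fun hf hg => ⟨hf.1.add hg.1, by rw [weighted_add]; exact hf.2.add hg.2⟩
  zero_mem' := ⟨differentiable_const 0, by rw [weighted_zero]; exact MemLp.zero⟩
  smul_mem' := fun c _ hf => ⟨hf.1.const_smul c, by rw [weighted_smul]; exact hf.2.const_smul c⟩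

/-- The vector space of entire functions `f` on `ℂⁿ` such that `|f| e^{-α|z|²/2}` is bounded. -/
def growthSubmodule (n : ℕ) (α : ℝ) : Submodule ℂ (CSpace n → ℂ) where
  carrier := {f | Differentiable ℂ f ∧ ∃ C : ℝ, ∀ z, ‖weighted α f z‖ ≤ C}
  add_mem' := by
    rintro f g ⟨hf, C, hC⟩ ⟨hg, D, hD⟩
    refine ⟨hf.add hg, C + D, fun z => ?_⟩
    rw [weighted_add]
    exact (norm_add_le _ _).trans (add_le_add (hC z) (hD z))
  zero_mem' := ⟨differentiable_const 0, 0, by simp [weighted_zero]⟩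
  smul_mem' := by
    rintro c f ⟨hf, C, hC⟩
    refine ⟨hf.const_smul c, ‖c‖ * C, fun z => ?_⟩
    rw [weighted_smul, Pi.smul_apply, norm_smul]
    exact mul_le_mul_of_nonneg_left (hC z) (norm_nonneg c)

end Fock

/-- The Fock space `F^p_α` on `ℂⁿ`, for finite `p`. -/
def FockSpace (n : ℕ) (α : ℝ) (p : ℝ≥0) : Type := Fock.fockSubmodule n α p

/-- The growth Fock space `F^∞_α` on `ℂⁿ`. -/
def GrowthFockSpace (n : ℕ) (α : ℝ) : Type := Fock.growthSubmodule n α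

namespace FockSpace

variable {n : ℕ} {α : ℝ} {p : ℝ≥0}

instance : AddCommGroup (FockSpace n α p) :=
  inferInstanceAs (AddCommGroup (Fock.fockSubmodule n α p))

instance : Module ℂ (FockSpace n α p) :=
  inferInstanceAs (Module ℂ (Fock.fockSubmodule n α p))

instance : CoeFun (FockSpace n α p) (fun _ => CSpace n → ℂ) := ⟨fun f => f.1⟩

/-- The map `f ↦ f e^{-α|z|²/2}` into `L^p((αp/2π)ⁿ dV)`. -/
def toLp (n : ℕ) (α : ℝ) (p : ℝ≥0) :
    FockSpace n α p →ₗ[ℂ] Lp ℂ p (Fock.normalizedVolume n α p) where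
  toFun f := MemLp.toLp (Fock.weighted α f) f.2.2
  map_add' f g := by
    rw [← MemLp.toLp_add]
    exact MemLp.toLp_congr _ _ (Filter.EventuallyEq.of_eq (Fock.weighted_add f.1 g.1))
  map_smul' c f := by
    rw [RingHom.id_apply, ← MemLp.toLp_const_smul]
    exact MemLp.toLp_congr _ _ (Filter.EventuallyEq.of_eq (Fock.weighted_smul c f.1))

theorem toLp_injective [Fact (0 < α)] [Fact (1 ≤ p)] :
    Function.Injective (toLp n α p) := by
  intro f g h
  have h1 : Fock.weighted α f =ᵐ[Fock.normalizedVolume n α p] Fock.weighted α g :=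
    (MemLp.toLp_eq_toLp_iff f.2.2 g.2.2).1 h
  have hc : ENNReal.ofReal ((α * p / (2 * Real.pi)) ^ n) ≠ 0 :=
    (ENNReal.ofReal_pos.2 Fock.mass_pos).ne'
  have h2 : Fock.weighted α f =ᵐ[volume] Fock.weighted α g := by
    unfold Fock.normalizedVolume at h1
    exact (Measure.ae_ennreal_smul_measure_iff hc).1 h1
  have h3 := (Continuous.ae_eq_iff_eq (volume : Measure (CSpace n))
    (Fock.continuous_weighted f.2.1.continuous) (Fock.continuous_weighted g.2.1.continuous)).1 h2
  exact Subtype.ext (Fock.weighted_injective h3)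

/-- The norm of `F^p_α`; it is given explicitly by `FockSpace.norm_eq`. -/
instance [Fact (0 < α)] [Fact (1 ≤ p)] : NormedAddCommGroup (FockSpace n α p) :=
  NormedAddCommGroup.induced _ _ (toLp n α p) toLp_injective

instance [Fact (0 < α)] [Fact (1 ≤ p)] : NormedSpace ℂ (FockSpace n α p) :=
  NormedSpace.induced ℂ _ _ (toLp n α p)

theorem norm_eq [Fact (0 < α)] [hp : Fact (1 ≤ p)] (f : FockSpace n α p) :
    ‖f‖ = ((α * p / (2 * Real.pi)) ^ n *
      ∫ z, ‖f z‖ ^ (p : ℝ) * Real.exp (-(α * p / 2) * ‖z‖ ^ 2)) ^ (1 / (p : ℝ)) := by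
  have hp0 : (p : ℝ≥0∞) ≠ 0 := by
    have : p ≠ 0 := (lt_of_lt_of_le one_pos hp.out).ne'
    exact_mod_cast this
  have h0 : ‖f‖ = ‖toLp n α p f‖ := rfl
  have h1 : ‖toLp n α p f‖
      = (eLpNorm (Fock.weighted α f) p (Fock.normalizedVolume n α p)).toReal :=
    Lp.norm_toLp _ f.2.2
  rw [h0, h1, MemLp.eLpNorm_eq_integral_rpow_norm hp0 ENNReal.coe_ne_top f.2.2,
    ENNReal.toReal_ofReal (by positivity), ENNReal.coe_toReal, Fock.normalizedVolume,
    integral_smul_measure, ENNReal.toReal_ofReal Fock.mass_pos.le, smul_eq_mul, one_div]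
  congr 3
  funext z
  rw [Fock.norm_weighted, Real.mul_rpow (norm_nonneg _) (Real.exp_pos _).le, ← Real.exp_mul]
  congr 2
  ring

end FockSpace

namespace GrowthFockSpace

variable {n : ℕ} {α : ℝ}

instance : AddCommGroup (GrowthFockSpace n α) :=
  inferInstanceAs (AddCommGroup (Fock.growthSubmodule n α))

instance : Module ℂ (GrowthFockSpace n α) :=
  inferInstanceAs (Module ℂ (Fock.growthSubmodule n α))

instance : CoeFun (GrowthFockSpace n α) (fun _ => CSpace n → ℂ) := ⟨fun f => f.1⟩

/-- The map `f ↦ f e^{-α|z|²/2}` into the bounded continuous functions with the sup norm. -/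
def toBCF (n : ℕ) (α : ℝ) :
    GrowthFockSpace n α →ₗ[ℂ] BoundedContinuousFunction (CSpace n) ℂ where
  toFun f := BoundedContinuousFunction.ofNormedAddCommGroup (Fock.weighted α f)
    (Fock.continuous_weighted f.2.1.continuous) f.2.2.choose f.2.2.choose_spec
  map_add' f g := by
    ext z; exact congrFun (Fock.weighted_add f.1 g.1) z
  map_smul' c f := by
    ext z; exact congrFun (Fock.weighted_smul c f.1) z

theorem toBCF_injective : Function.Injective (toBCF n α) := by
  intro f g h
  refine Subtype.ext (Fock.weighted_injective (α := α) (funext fun z => ?_))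
  exact DFunLike.congr_fun h z

/-- The norm of `F^∞_α`; it is given explicitly by `GrowthFockSpace.norm_eq`. -/
instance : NormedAddCommGroup (GrowthFockSpace n α) :=
  NormedAddCommGroup.induced _ _ (toBCF n α) toBCF_injective

instance : NormedSpace ℂ (GrowthFockSpace n α) :=
  NormedSpace.induced ℂ _ _ (toBCF n α)

theorem norm_eq (f : GrowthFockSpace n α) :
    ‖f‖ = ⨆ z, ‖f z‖ * Real.exp (-(α / 2) * ‖z‖ ^ 2) := by
  have h0 : ‖f‖ = ‖toBCF n α f‖ := rfl
  rw [h0, BoundedContinuousFunction.norm_eq_iSup_norm]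
  exact iSup_congr fun z => Fock.norm_weighted f.1 z

end GrowthFockSpace

namespace Fock

variable {n : ℕ}

/-- The reproducing kernel `K_w(z) = e^{α⟨z, w⟩}` with `⟨z, w⟩ = ∑ⱼ zⱼ conj(wⱼ)`
(Mathlib's `inner ℂ w z`, conjugate linear in its first argument). -/
def kernel (α : ℝ) (w z : CSpace n) : ℂ := Complex.exp (α * inner ℂ w z)

theorem kernel_eq (α : ℝ) (w z : CSpace n) :
    kernel α w z = Complex.exp (α * ∑ j, z j * (starRingEnd ℂ) (w j)) := by
  simp [kernel, PiLp.inner_apply]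

/-- The admissibility condition `∫ |K_w(z)|² e^{-α|w|²} dμ(w) < ∞` for all `z`. -/
def Admissible (α : ℝ) (μ : Measure (CSpace n)) : Prop :=
  ∀ z : CSpace n,
    ∫⁻ w, ENNReal.ofReal (‖kernel α w z‖ ^ 2 * Real.exp (-α * ‖w‖ ^ 2)) ∂μ < ∞

/-- The integrand `w ↦ K_w(z) f(w) e^{-α|w|²}` of the Toeplitz operator. -/
def toeplitzIntegrand (α : ℝ) (f : CSpace n → ℂ) (z w : CSpace n) : ℂ :=
  kernel α w z * f w * (Real.exp (-α * ‖w‖ ^ 2) : ℂ)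

/-- `f` is in the natural domain of `T_μ`: the integral defining `T_μ f(z)` converges absolutely
for every `z`. -/
def InToeplitzDomain (α : ℝ) (μ : Measure (CSpace n)) (f : CSpace n → ℂ) : Prop :=
  ∀ z, Integrable (toeplitzIntegrand α f z) μ

/-- `T_μ f(z) = ∫ K_w(z) f(w) e^{-α|w|²} dμ(w)`, for `f` in the domain of `T_μ`. -/
def toeplitz (α : ℝ) (μ : Measure (CSpace n)) (f : CSpace n → ℂ) (z : CSpace n) : ℂ :=
  ∫ w, toeplitzIntegrand α f z w ∂μ

variable {α : ℝ} [Fact (0 < α)] {p : ℝ≥0} [Fact (1 ≤ p)]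

/-- The bounded operator `T : F^p_α → F^∞_α` is the densely defined operator `T_μ`, that is, it
agrees with `T_μ` on the part of `F^p_α` where the defining integral converges. -/
def IsToeplitz (μ : Measure (CSpace n)) (T : FockSpace n α p →L[ℂ] GrowthFockSpace n α) : Prop :=
  ∀ f : FockSpace n α p, InToeplitzDomain α μ f → ∀ z, T f z = toeplitz α μ f z

variable (α p) in
/-- `T_μ : F^p_α → F^∞_α` is bounded. -/
def ToeplitzBounded (μ : Measure (CSpace n)) : Prop :=
  ∃ T : FockSpace n α p →L[ℂ] GrowthFockSpace n α, IsToeplitz μ T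

variable (α p) in
/-- `T_μ : F^p_α → F^∞_α` is compact. -/
def ToeplitzCompact (μ : Measure (CSpace n)) : Prop :=
  ∃ T : FockSpace n α p →L[ℂ] GrowthFockSpace n α, IsToeplitz μ T ∧ IsCompactOperator T

variable (α p) in
/-- `μ` is a `(p, q)` Fock–Carleson measure. -/
def IsFockCarleson (q : ℝ≥0) (μ : Measure (CSpace n)) : Prop :=
  ∃ C : ℝ, ∀ f : FockSpace n α p,
    ∫⁻ z, ENNReal.ofReal (‖f z‖ ^ (q : ℝ) * Real.exp (-(α * q / 2) * ‖z‖ ^ 2)) ∂μ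
      ≤ ENNReal.ofReal (C * ‖f‖ ^ (q : ℝ))

/-- The measure `dσ_q(z) = e^{-qα|z|²/2} dμ(z)`. -/
def sigma (α : ℝ) (q : ℝ≥0) (μ : Measure (CSpace n)) : Measure (CSpace n) :=
  μ.withDensity fun z => ENNReal.ofReal (Real.exp (-(α * q / 2) * ‖z‖ ^ 2))

/-- `J` is the embedding `I_μ : F^p_α → L^q(σ_q)`, `f ↦ f`. -/
def IsEmbedding {q : ℝ≥0} [Fact (1 ≤ q)] (μ : Measure (CSpace n))
    (J : FockSpace n α p →L[ℂ] Lp ℂ q (sigma α q μ)) : Prop :=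
  ∀ f : FockSpace n α p, J f =ᵐ[sigma α q μ] f

variable (α p) in
/-- `μ` is a `(p, q)` vanishing Fock–Carleson measure: the embedding `F^p_α → L^q(σ_q)` is
compact. -/
def IsVanishingFockCarleson (q : ℝ≥0) [Fact (1 ≤ q)] (μ : Measure (CSpace n)) : Prop :=
  ∃ J : FockSpace n α p →L[ℂ] Lp ℂ q (sigma α q μ), IsEmbedding μ J ∧ IsCompactOperator J

end Fock

end

/-!
Everything is controlled by the single function `a ↦ μ(B(a,1))`: boundedness of `T_μ`, and the
`(1,q)` Carleson property for any one `q`, both say that it is bounded, and the corresponding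
compactness properties both say that it tends to `0` at infinity. Neither condition mentions `p`
or `q`, whence all the equivalences, and every norm involved is comparable with `sup μ(B(a,1))`.

*Necessity.* The normalized kernels `k_a` (`coherentState`) have a norm in `F^p_α` which does not
depend on `a`, and `|k_a(z)| e^{-α|z|²/2} = e^{-α|z-a|²/2}`. Testing a Carleson inequality on `k_a`
bounds `∫ e^{-β|w-a|²} dμ(w)`, hence `μ(B(a,1))`; for `T_μ` the same integral (with `β = α`) is
the weighted value of `T_μ k_a` at `a`
(`Admissible.enorm_weighted_toeplitz_coherentFun`). For compact operators one needs that the images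
of `k_a` tend to `0` in norm as `a → ∞`. Since `k_a` need not tend weakly to `0` when `p = 1`, this
is deduced from compactness and *pointwise* convergence of the images to `0`
(`tendsto_zero_of_isCompactOperator`).

*Sufficiency.* `|f|^p e^{-pα|z|²/2}` has a local sub-mean-value property
(`volume_mul_enorm_weighted_rpow_le_lintegral`). Integrating it against `μ` and exchanging integrals
(`UnitBallBound.lintegral_le`) gives `∫ |f|^q dσ_q ≤ C sup_a μ(B(a,1)) ‖f‖_p^q` for `q ≥ p`, the
inclusion `F^p_α ⊆ F^∞_α` being the case of a Dirac mass. The operator `T_μ` is the composition of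
the embedding `F^p_α → L^p(σ_p)` with the operator `L^p(σ_p) → F^∞_α` given by the same integral
(`exists_lp_toeplitz`). If `μ(B(a,1)) → 0`, the image of the unit ball under an embedding is totally
bounded: on a large ball Arzelà–Ascoli applies, and outside it the Carleson inequality for the
restriction of `μ` gives a small norm (`isCompactOperator_of_tendsto_measure_ball`). Factoring `T_μ`
through the complete space `L^p(σ_p)` transfers compactness to it.
-/

noncomputable section

open Metric Filter Topology

/-! ### Sub-mean-value property and Carleson inequalities -/

namespace Fock

variable {n : ℕ} {α : ℝ}

theorem volume_unitBall_ne_zero : volume (ball (0 : CSpace n) 1) ≠ 0 :=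
  (measure_ball_pos volume _ one_pos).ne'

theorem volume_unitBall_ne_top : volume (ball (0 : CSpace n) 1) ≠ ∞ :=
  measure_ball_lt_top.ne

theorem measurePreserving_circle_smul (θ : ℝ) :
    MeasurePreserving (fun u : CSpace n => Complex.exp (θ * Complex.I) • u) volume volume := by
  let e : CSpace n ≃ₗᵢ[ℝ] CSpace n :=
    { (LinearEquiv.smulOfNeZero ℂ (CSpace n) _ (Complex.exp_ne_zero (θ * Complex.I))).restrictScalars ℝ
        with
      norm_map' := fun u => by
        change ‖Complex.exp (θ * Complex.I) • u‖ = ‖u‖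
        rw [norm_smul, Complex.norm_exp_ofReal_mul_I, one_mul] }
  exact e.measurePreserving

/-- Mean value inequality on the unit ball: the mean value property on every circle `e^{iθ}u`,
averaged over `u`. -/
theorem volume_mul_enorm_le_lintegral {g : CSpace n → ℂ} (hg : Differentiable ℂ g) :
    volume (ball (0 : CSpace n) 1) * ‖g 0‖ₑ ≤ ∫⁻ u in ball (0 : CSpace n) 1, ‖g u‖ₑ := by
  set B : Set (CSpace n) := ball 0 1
  have hc : ∀ u : CSpace n, ENNReal.ofReal (2 * Real.pi) * ‖g 0‖ₑ ≤
      ∫⁻ θ in Set.Ioc 0 (2 * Real.pi), ‖g (Complex.exp (θ * Complex.I) • u)‖ₑ := by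
    intro u
    have h1 : Real.circleAverage (fun t : ℂ => g (t • u)) 0 1 = g 0 := by
      have hd : Differentiable ℂ (fun t : ℂ => g (t • u)) := by fun_prop
      simpa using hd.diffContOnCl.circleAverage (c := 0) (R := 1)
    rw [Real.circleAverage, intervalIntegral.integral_of_le Real.two_pi_pos.le] at h1
    rw [← h1, enorm_smul, ← mul_assoc]
    have h2 : ENNReal.ofReal (2 * Real.pi) * ‖(2 * Real.pi)⁻¹‖ₑ = 1 := by
      rw [← ofReal_norm, Real.norm_of_nonneg (by positivity),
        ← ENNReal.ofReal_mul (by positivity), mul_inv_cancel₀ (by positivity), ENNReal.ofReal_one]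
    rw [h2, one_mul]
    refine (enorm_integral_le_lintegral_enorm _).trans (le_of_eq ?_)
    simp [circleMap]
  have hpi : ENNReal.ofReal (2 * Real.pi) ≠ 0 := by simp [Real.pi_pos]
  have hpi' : ENNReal.ofReal (2 * Real.pi) ≠ ∞ := ENNReal.ofReal_ne_top
  rw [← ENNReal.mul_le_mul_iff_right hpi hpi']
  have hrot : ∀ θ : ℝ, ∫⁻ u in B, ‖g (Complex.exp (θ * Complex.I) • u)‖ₑ = ∫⁻ u in B, ‖g u‖ₑ := by
    intro θ
    have hB : (fun u : CSpace n => Complex.exp (θ * Complex.I) • u) ⁻¹' B = B := by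
      ext u
      simp [B, norm_smul, Complex.norm_exp_ofReal_mul_I]
    conv_lhs => rw [← hB]
    exact (measurePreserving_circle_smul θ).setLIntegral_comp_preimage measurableSet_ball
      hg.continuous.measurable.enorm
  calc ENNReal.ofReal (2 * Real.pi) * (volume B * ‖g 0‖ₑ)
      = ∫⁻ _ in B, ENNReal.ofReal (2 * Real.pi) * ‖g 0‖ₑ := by
        rw [setLIntegral_const]; ring
    _ ≤ ∫⁻ u in B, ∫⁻ θ in Set.Ioc 0 (2 * Real.pi), ‖g (Complex.exp (θ * Complex.I) • u)‖ₑ :=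
        lintegral_mono fun u => hc u
    _ = ∫⁻ θ in Set.Ioc 0 (2 * Real.pi), ∫⁻ u in B, ‖g (Complex.exp (θ * Complex.I) • u)‖ₑ := by
        refine lintegral_lintegral_swap (Measurable.aemeasurable ?_)
        have : Continuous fun x : CSpace n × ℝ => g (Complex.exp (x.2 * Complex.I) • x.1) :=
          hg.continuous.comp (by fun_prop)
        exact this.measurable.enorm
    _ = ENNReal.ofReal (2 * Real.pi) * ∫⁻ u in B, ‖g u‖ₑ := by
        simp_rw [hrot]
        rw [setLIntegral_const, Real.volume_Ioc, sub_zero, mul_comm]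

/-- The `q`-th power version of `volume_mul_enorm_le_lintegral`, by Hölder's inequality on the
unit ball. -/
theorem volume_mul_enorm_rpow_le_lintegral {g : CSpace n → ℂ} (hg : Differentiable ℂ g)
    {q : ℝ≥0} (hq : 1 ≤ q) :
    volume (ball (0 : CSpace n) 1) * ‖g 0‖ₑ ^ (q : ℝ) ≤
      ∫⁻ u in ball (0 : CSpace n) 1, ‖g u‖ₑ ^ (q : ℝ) := by
  set B : Set (CSpace n) := ball 0 1
  have hq' : (1 : ℝ) ≤ q := by exact_mod_cast hq
  have hq0 : (0 : ℝ) < q := by linarith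
  have h1 := volume_mul_enorm_le_lintegral hg
  have h2 := eLpNorm_le_eLpNorm_mul_rpow_measure_univ (μ := volume.restrict B) (f := g)
    (p := 1) (q := q) (by exact_mod_cast hq) hg.continuous.aestronglyMeasurable
  rw [eLpNorm_one_eq_lintegral_enorm, eLpNorm_nnreal_eq_lintegral (by positivity),
    Measure.restrict_apply_univ] at h2
  have h3 := ENNReal.rpow_le_rpow (h1.trans h2) hq0.le
  rw [ENNReal.mul_rpow_of_nonneg _ _ hq0.le, ENNReal.mul_rpow_of_nonneg _ _ hq0.le,
    ← ENNReal.rpow_mul, ← ENNReal.rpow_mul, one_div, inv_mul_cancel₀ hq0.ne', ENNReal.rpow_one] at h3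
  have h4 : (1 / (1 : ℝ≥0∞).toReal - 1 / (q : ℝ≥0∞).toReal) * (q : ℝ) = q - 1 := by
    simp; field_simp
  rw [h4] at h3
  have hB0 : volume B ≠ 0 := volume_unitBall_ne_zero
  have hBt : volume B ≠ ∞ := volume_unitBall_ne_top
  have h5 : volume B ^ (q : ℝ) = volume B * volume B ^ ((q : ℝ) - 1) := by
    conv_rhs => enter [1]; rw [← ENNReal.rpow_one (volume B)]
    rw [← ENNReal.rpow_add _ _ hB0 hBt]; congr 1; ring
  rw [h5, mul_right_comm] at h3
  exact (ENNReal.mul_le_mul_iff_left (ENNReal.rpow_pos hB0.bot_lt hBt).ne'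
    (ENNReal.rpow_ne_top_of_nonneg (by linarith) hBt)).1 h3

/-- `|f|^q e^{-qα|z|²/2}` satisfies a local sub-mean-value inequality. The mean value inequality is
applied to `u ↦ f(z+u) e^{-α⟨u,z⟩}`, whose modulus is comparable with the weighted one near `0`. -/
theorem volume_mul_enorm_weighted_rpow_le_lintegral (hα : 0 ≤ α) {f : CSpace n → ℂ}
    (hf : Differentiable ℂ f) {q : ℝ≥0} (hq : 1 ≤ q) (z : CSpace n) :
    volume (ball (0 : CSpace n) 1) * ‖weighted α f z‖ₑ ^ (q : ℝ) ≤
      ∫⁻ u in ball z 1, ENNReal.ofReal (Real.exp (α / 2)) ^ (q : ℝ) *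
        ‖weighted α f u‖ₑ ^ (q : ℝ) := by
  let g : CSpace n → ℂ := fun u => f (z + u) * Complex.exp (-(α * inner ℂ z u)) *
    (Real.exp (-(α / 2) * ‖z‖ ^ 2) : ℂ)
  have hg : Differentiable ℂ g := by
    have : Differentiable ℂ fun u : CSpace n => inner ℂ z u := (innerSL ℂ z).differentiable
    unfold g
    fun_prop
  have hgn : ∀ u, ‖g u‖ = Real.exp (α / 2 * ‖u‖ ^ 2) * ‖weighted α f (z + u)‖ := by
    intro u
    have h1 : ‖z + u‖ ^ 2 = ‖z‖ ^ 2 + 2 * (inner ℂ z u).re + ‖u‖ ^ 2 := norm_add_sq (𝕜 := ℂ) z u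
    simp only [g, norm_weighted, norm_mul, Complex.norm_real, Complex.norm_exp, Real.norm_eq_abs,
      Real.abs_exp]
    rw [mul_left_comm, ← Real.exp_add, mul_assoc, ← Real.exp_add, h1]
    congr 2
    simp
    ring
  have h0 : ‖g 0‖ₑ = ‖weighted α f z‖ₑ := by
    rw [← ofReal_norm, hgn]; simp
  have h := volume_mul_enorm_rpow_le_lintegral hg hq
  rw [h0] at h
  refine h.trans ?_
  have hB : (fun u => z + u) ⁻¹' (ball z 1) = ball (0 : CSpace n) 1 := by
    ext u; simp
  have ht := (measurePreserving_add_left volume z).setLIntegral_comp_preimage_emb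
    (measurableEmbedding_addLeft z) (fun u => ENNReal.ofReal (Real.exp (α / 2)) ^ (q : ℝ) *
        ‖weighted α f u‖ₑ ^ (q : ℝ)) (ball z 1)
  rw [hB] at ht
  rw [← ht]
  refine setLIntegral_mono' measurableSet_ball fun u hu => ?_
  rw [← ENNReal.mul_rpow_of_nonneg _ _ q.coe_nonneg]
  refine ENNReal.rpow_le_rpow ?_ q.coe_nonneg
  rw [← ofReal_norm, ← ofReal_norm, ← ENNReal.ofReal_mul (Real.exp_pos _).le, hgn]
  have : ‖u‖ < 1 := by simpa using hu
  gcongr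
  nlinarith [norm_nonneg u, mul_nonneg hα (norm_nonneg u)]

/-- `M` bounds the mass that `μ` gives to the unit balls. -/
def UnitBallBound (μ : Measure (CSpace n)) (M : ℝ≥0) : Prop := ∀ a, μ (ball a 1) ≤ M

theorem UnitBallBound.isLocallyFiniteMeasure {μ : Measure (CSpace n)} {M : ℝ≥0}
    (hM : UnitBallBound μ M) : IsLocallyFiniteMeasure μ :=
  ⟨fun a => ⟨ball a 1, ball_mem_nhds a one_pos, (hM a).trans_lt ENNReal.coe_lt_top⟩⟩

/-- Integrating a local mean value bound: by Tonelli, `∫ ∫_{B(w,1)} ψ dV dμ(w) = ∫ ψ(u) μ(B(u,1)) dV(u)`. -/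
theorem UnitBallBound.lintegral_le {μ : Measure (CSpace n)} {M : ℝ≥0} (hM : UnitBallBound μ M)
    {φ ψ : CSpace n → ℝ≥0∞} (hψ : Measurable ψ) (h : ∀ w, φ w ≤ ∫⁻ u in ball w 1, ψ u) :
    ∫⁻ w, φ w ∂μ ≤ M * ∫⁻ u, ψ u := by
  have := hM.isLocallyFiniteMeasure
  have hS : MeasurableSet {x : CSpace n × CSpace n | dist x.2 x.1 < 1} :=
    (isOpen_lt (by fun_prop) (by fun_prop)).measurableSet
  calc ∫⁻ w, φ w ∂μ ≤ ∫⁻ w, ∫⁻ u in ball w 1, ψ u ∂volume ∂μ := lintegral_mono h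
    _ = ∫⁻ w, ∫⁻ u, {x : CSpace n × CSpace n | dist x.2 x.1 < 1}.indicator
          (fun x => ψ x.2) (w, u) ∂volume ∂μ := by
        refine lintegral_congr fun w => ?_
        rw [← lintegral_indicator measurableSet_ball]
        rfl
    _ = ∫⁻ u, ∫⁻ w, {x : CSpace n × CSpace n | dist x.2 x.1 < 1}.indicator
          (fun x => ψ x.2) (w, u) ∂μ ∂volume :=
        lintegral_lintegral_swap ((hψ.comp measurable_snd).indicator hS).aemeasurable
    _ = ∫⁻ u, ψ u * μ (ball u 1) := by
        refine lintegral_congr fun u => ?_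
        rw [← setLIntegral_const, ← lintegral_indicator measurableSet_ball]
        refine lintegral_congr fun w => ?_
        by_cases hwu : dist w u < 1
        · rw [Set.indicator_of_mem (show w ∈ ball u 1 from hwu),
            Set.indicator_of_mem (by rwa [dist_comm] at hwu)]
        · rw [Set.indicator_of_notMem (show w ∉ ball u 1 from hwu),
            Set.indicator_of_notMem (by rwa [dist_comm] at hwu)]
    _ ≤ ∫⁻ u, ψ u * M := lintegral_mono fun u => mul_le_mul_right (hM u) _
    _ = M * ∫⁻ u, ψ u := by rw [lintegral_mul_const _ hψ, mul_comm]

theorem integrable_exp_neg_mul_sq {β : ℝ} (hβ : 0 < β) :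
    Integrable (fun v : CSpace n => Real.exp (-β * ‖v‖ ^ 2)) := by
  have := (GaussianFourier.integrable_cexp_neg_mul_sq_norm_add (V := CSpace n) (b := β)
    (by simpa) 0 0).norm
  refine this.congr (Filter.Eventually.of_forall fun v => ?_)
  simp only [Complex.norm_exp]
  congr 1
  simp [← Complex.ofReal_pow]

theorem lintegral_exp_neg_mul_sq_lt_top {β : ℝ} (hβ : 0 < β) :
    ∫⁻ v : CSpace n, ENNReal.ofReal (Real.exp (-β * ‖v‖ ^ 2)) < ∞ :=
  (integrable_exp_neg_mul_sq hβ).lintegral_lt_top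

theorem lintegral_exp_neg_mul_sq_sub (β : ℝ) (z : CSpace n) :
    ∫⁻ v : CSpace n, ENNReal.ofReal (Real.exp (-β * ‖v - z‖ ^ 2)) =
      ∫⁻ v : CSpace n, ENNReal.ofReal (Real.exp (-β * ‖v‖ ^ 2)) :=
  lintegral_sub_right_eq_self (fun v : CSpace n => ENNReal.ofReal (Real.exp (-β * ‖v‖ ^ 2))) z

variable (n) in
/-- Gaussian integrals of `μ` are bounded, uniformly in the centre: the Gaussian of rate `β` at `w`
is at most a constant times the mean over `B(w,1)` of the Gaussian of rate `β/2`. -/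
theorem exists_lintegral_gaussian_le {β : ℝ} (hβ : 0 < β) :
    ∃ C : ℝ≥0, ∀ (μ : Measure (CSpace n)) (M : ℝ≥0), UnitBallBound μ M → ∀ z,
      ∫⁻ w, ENNReal.ofReal (Real.exp (-β * ‖w - z‖ ^ 2)) ∂μ ≤ C * M := by
  set V := volume (ball (0 : CSpace n) 1) with hV
  have hV0 : V ≠ 0 := volume_unitBall_ne_zero
  have hVt : V ≠ ∞ := volume_unitBall_ne_top
  set I := ∫⁻ v : CSpace n, ENNReal.ofReal (Real.exp (-(β / 2) * ‖v‖ ^ 2))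
  have hI : I ≠ ∞ := (lintegral_exp_neg_mul_sq_lt_top (half_pos hβ)).ne
  set D : ℝ≥0∞ := V⁻¹ * ENNReal.ofReal (Real.exp β)
  have hD : D ≠ ∞ := ENNReal.mul_ne_top (ENNReal.inv_ne_top.2 hV0) ENNReal.ofReal_ne_top
  refine ⟨(D * I).toNNReal, fun μ M hM z => ?_⟩
  rw [ENNReal.coe_toNNReal (ENNReal.mul_ne_top hD hI)]
  have hmeas : Measurable fun u : CSpace n =>
      ENNReal.ofReal (Real.exp (-(β / 2) * ‖u - z‖ ^ 2)) := by fun_prop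
  refine (hM.lintegral_le (ψ := fun u => D * ENNReal.ofReal (Real.exp (-(β / 2) * ‖u - z‖ ^ 2)))
    (by fun_prop) fun w => ?_).trans_eq ?_
  · have hw : volume (ball w 1) = V := Measure.addHaar_ball_center _ _ _
    calc ENNReal.ofReal (Real.exp (-β * ‖w - z‖ ^ 2))
        = ∫⁻ _ in ball w 1, V⁻¹ * ENNReal.ofReal (Real.exp (-β * ‖w - z‖ ^ 2)) := by
          rw [setLIntegral_const, hw, mul_right_comm, ENNReal.inv_mul_cancel hV0 hVt, one_mul]
      _ ≤ _ := by
          refine setLIntegral_mono' measurableSet_ball fun u hu => ?_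
          rw [mul_assoc, ← ENNReal.ofReal_mul (Real.exp_pos _).le, ← Real.exp_add]
          gcongr
          have h1 : ‖u - z‖ ≤ 1 + ‖w - z‖ := by
            have h2 : dist u w < 1 := hu
            rw [dist_eq_norm] at h2
            have := norm_add_le (u - w) (w - z)
            rw [sub_add_sub_cancel] at this
            linarith
          have h2 : ‖u - z‖ ^ 2 ≤ 2 + 2 * ‖w - z‖ ^ 2 := by
            nlinarith [norm_nonneg (u - z), sq_nonneg (1 - ‖w - z‖)]
          nlinarith
  · rw [lintegral_const_mul _ hmeas, lintegral_exp_neg_mul_sq_sub]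
    ring

variable {p : ℝ≥0} [Fact (0 < α)] [Fact (1 ≤ p)]

theorem lintegral_weighted_rpow (f : FockSpace n α p) :
    ∫⁻ z, ‖weighted α f z‖ₑ ^ (p : ℝ) =
      (ENNReal.ofReal ((α * p / (2 * Real.pi)) ^ n))⁻¹ * ‖f‖ₑ ^ (p : ℝ) := by
  have hp : (0 : ℝ) < p := by exact_mod_cast zero_lt_one.trans_le (Fact.out : 1 ≤ p)
  have h0 : ‖f‖ₑ = ‖FockSpace.toLp n α p f‖ₑ := rfl
  have h1 : ‖FockSpace.toLp n α p f‖ₑ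
      = eLpNorm (weighted α f) p (normalizedVolume n α p) := Lp.enorm_toLp f.2.2
  have hc : ENNReal.ofReal ((α * p / (2 * Real.pi)) ^ n) ≠ 0 :=
    (ENNReal.ofReal_pos.2 mass_pos).ne'
  rw [h0, h1, eLpNorm_nnreal_eq_lintegral (by exact_mod_cast hp.ne'), ← ENNReal.rpow_mul, one_div,
    inv_mul_cancel₀ hp.ne', ENNReal.rpow_one, normalizedVolume, lintegral_smul_measure, smul_eq_mul,
    ← mul_assoc, ENNReal.inv_mul_cancel hc ENNReal.ofReal_ne_top, one_mul]

variable (n α p) in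
/-- The Carleson inequality with equal exponents, from the local sub-mean-value property. -/
theorem exists_lintegral_weighted_rpow_self_le :
    ∃ C : ℝ≥0, ∀ (μ : Measure (CSpace n)) (M : ℝ≥0), UnitBallBound μ M → ∀ f : FockSpace n α p,
      ∫⁻ w, ‖weighted α f w‖ₑ ^ (p : ℝ) ∂μ ≤ C * M * ‖f‖ₑ ^ (p : ℝ) := by
  have hα : 0 < α := Fact.out
  set V := volume (ball (0 : CSpace n) 1) with hV
  have hV0 : V ≠ 0 := volume_unitBall_ne_zero
  have hVt : V ≠ ∞ := volume_unitBall_ne_top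
  set D : ℝ≥0∞ := V⁻¹ * ENNReal.ofReal (Real.exp (α / 2)) ^ (p : ℝ)
  have hD : D ≠ ∞ := ENNReal.mul_ne_top (ENNReal.inv_ne_top.2 hV0)
    (ENNReal.rpow_ne_top_of_nonneg p.2 ENNReal.ofReal_ne_top)
  set c := (ENNReal.ofReal ((α * p / (2 * Real.pi)) ^ n))⁻¹
  have hc : c ≠ ∞ := ENNReal.inv_ne_top.2 (ENNReal.ofReal_pos.2 mass_pos).ne'
  refine ⟨(D * c).toNNReal, fun μ M hM f => ?_⟩
  rw [ENNReal.coe_toNNReal (ENNReal.mul_ne_top hD hc)]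
  have hmeas : Measurable fun u => ‖weighted α f u‖ₑ ^ (p : ℝ) :=
    (continuous_weighted f.2.1.continuous).measurable.enorm.pow_const _
  refine (hM.lintegral_le (ψ := fun u => D * ‖weighted α f u‖ₑ ^ (p : ℝ))
    (hmeas.const_mul _) fun w => ?_).trans_eq ?_
  · have h := volume_mul_enorm_weighted_rpow_le_lintegral hα.le f.2.1 (Fact.out : 1 ≤ p) w
    have h' := mul_le_mul_right h V⁻¹
    rw [← mul_assoc, ENNReal.inv_mul_cancel hV0 hVt, one_mul,
      ← lintegral_const_mul _ (hmeas.const_mul _)] at h'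
    simpa only [D, mul_assoc] using h'
  · rw [lintegral_const_mul _ hmeas, lintegral_weighted_rpow]
    ring

variable (n α p) in
/-- The bounded inclusion of `F^p_α` in `F^∞_α`: the Carleson inequality for Dirac masses. -/
theorem exists_enorm_weighted_le :
    ∃ C : ℝ≥0, ∀ (f : FockSpace n α p) z, ‖weighted α f z‖ₑ ≤ C * ‖f‖ₑ := by
  have hp : (0 : ℝ) < p := by exact_mod_cast zero_lt_one.trans_le (Fact.out : 1 ≤ p)
  obtain ⟨C, hC⟩ := exists_lintegral_weighted_rpow_self_le n α p
  refine ⟨C ^ (p : ℝ)⁻¹, fun f z => ?_⟩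
  have h1 : UnitBallBound (Measure.dirac z) 1 := fun a => by
    simpa using prob_le_one (μ := Measure.dirac z) (s := ball a 1)
  have h2 := hC _ _ h1 f
  have hmeas : Measurable fun u => ‖weighted α f u‖ₑ ^ (p : ℝ) :=
    (continuous_weighted f.2.1.continuous).measurable.enorm.pow_const _
  rw [lintegral_dirac' _ hmeas, ENNReal.coe_one, mul_one, ← ENNReal.le_rpow_inv_iff hp,
    ENNReal.mul_rpow_of_nonneg _ _ (by positivity), ← ENNReal.rpow_mul, mul_inv_cancel₀ hp.ne',
    ENNReal.rpow_one] at h2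
  rwa [ENNReal.coe_rpow_of_nonneg _ (by positivity)]

variable (n α p) in
/-- The Carleson inequality for `q ≥ p`: `q - p` powers of `|f| e^{-α|z|²/2}` are estimated by its
supremum. -/
theorem exists_lintegral_weighted_rpow_le {q : ℝ≥0} (hpq : p ≤ q) :
    ∃ C : ℝ≥0, ∀ (μ : Measure (CSpace n)) (M : ℝ≥0), UnitBallBound μ M → ∀ f : FockSpace n α p,
      ∫⁻ w, ‖weighted α f w‖ₑ ^ (q : ℝ) ∂μ ≤ C * M * ‖f‖ₑ ^ (q : ℝ) := by
  have hpq' : (0 : ℝ) ≤ q - p := by simpa using hpq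
  obtain ⟨C₁, h₁⟩ := exists_lintegral_weighted_rpow_self_le n α p
  obtain ⟨C₂, h₂⟩ := exists_enorm_weighted_le n α p
  refine ⟨C₂ ^ ((q : ℝ) - p) * C₁, fun μ M hM f => ?_⟩
  have hmeas : Measurable fun u => ‖weighted α f u‖ₑ ^ (p : ℝ) :=
    (continuous_weighted f.2.1.continuous).measurable.enorm.pow_const _
  have hsplit : ∀ x : ℝ≥0∞, x ^ (q : ℝ) = x ^ ((q : ℝ) - p) * x ^ (p : ℝ) := fun x => by
    rw [← ENNReal.rpow_add_of_nonneg _ _ hpq' p.coe_nonneg, sub_add_cancel]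
  calc ∫⁻ w, ‖weighted α f w‖ₑ ^ (q : ℝ) ∂μ
      ≤ ∫⁻ w, (C₂ * ‖f‖ₑ) ^ ((q : ℝ) - p) * ‖weighted α f w‖ₑ ^ (p : ℝ) ∂μ := by
        refine lintegral_mono fun w => ?_
        rw [hsplit]
        gcongr
        exact h₂ f w
    _ ≤ (C₂ * ‖f‖ₑ) ^ ((q : ℝ) - p) * (C₁ * M * ‖f‖ₑ ^ (p : ℝ)) := by
        rw [lintegral_const_mul _ hmeas]
        gcongr
        exact h₁ μ M hM f
    _ = _ := by
        rw [hsplit ‖f‖ₑ, ENNReal.mul_rpow_of_nonneg _ _ hpq', ENNReal.coe_mul,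
          ENNReal.coe_rpow_of_nonneg _ hpq']
        ring

end Fock

/-! ### Normalized kernels and embeddings -/

namespace Fock

variable {n : ℕ} {α : ℝ}

theorem norm_kernel_mul_exp (a z : CSpace n) :
    ‖kernel α a z‖ * Real.exp (-(α / 2) * ‖z‖ ^ 2) * Real.exp (-(α / 2) * ‖a‖ ^ 2) =
      Real.exp (-(α / 2) * ‖z - a‖ ^ 2) := by
  have h1 : ‖z - a‖ ^ 2 = ‖z‖ ^ 2 - 2 * (inner ℂ a z).re + ‖a‖ ^ 2 := by
    rw [← norm_sub_rev a z, norm_sub_sq (𝕜 := ℂ) a z]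
    change ‖a‖ ^ 2 - 2 * (inner ℂ a z).re + ‖z‖ ^ 2 = _
    ring
  rw [kernel, Complex.norm_exp, ← Real.exp_add, ← Real.exp_add, h1]
  congr 1
  simp
  ring

theorem differentiable_kernel (a : CSpace n) : Differentiable ℂ (kernel α a) := by
  have : Differentiable ℂ fun u : CSpace n => inner ℂ a u := (innerSL ℂ a).differentiable
  unfold kernel
  fun_prop

theorem continuous_kernel_left (z : CSpace n) : Continuous fun w => kernel α w z := by
  unfold kernel
  fun_prop

variable (α) in
/-- The function `z ↦ K_a(z) e^{-α|a|²/2}`. -/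
def coherentFun (a z : CSpace n) : ℂ := kernel α a z * (Real.exp (-(α / 2) * ‖a‖ ^ 2) : ℂ)

theorem norm_weighted_coherentFun (a z : CSpace n) :
    ‖weighted α (coherentFun α a) z‖ = Real.exp (-(α / 2) * ‖z - a‖ ^ 2) := by
  rw [norm_weighted, coherentFun, norm_mul, Complex.norm_real, Real.norm_eq_abs, Real.abs_exp,
    mul_right_comm, norm_kernel_mul_exp]

theorem enorm_weighted_coherentFun_rpow (a z : CSpace n) (q : ℝ≥0) :
    ‖weighted α (coherentFun α a) z‖ₑ ^ (q : ℝ) =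
      ENNReal.ofReal (Real.exp (-(α / 2 * q) * ‖z - a‖ ^ 2)) := by
  rw [← ofReal_norm, norm_weighted_coherentFun, ENNReal.ofReal_rpow_of_pos (Real.exp_pos _),
    ← Real.exp_mul]
  congr 2
  ring

theorem differentiable_coherentFun (a : CSpace n) : Differentiable ℂ (coherentFun α a) :=
  (differentiable_kernel a).mul_const _

theorem enorm_weighted_rpow (f : CSpace n → ℂ) (z : CSpace n) (q : ℝ≥0) :
    ‖weighted α f z‖ₑ ^ (q : ℝ) =
      ‖f z‖ₑ ^ (q : ℝ) * ENNReal.ofReal (Real.exp (-(α * q / 2) * ‖z‖ ^ 2)) := by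
  rw [← ofReal_norm, norm_weighted, ENNReal.ofReal_mul (norm_nonneg _),
    ENNReal.mul_rpow_of_nonneg _ _ q.coe_nonneg, ofReal_norm,
    ENNReal.ofReal_rpow_of_pos (Real.exp_pos _), ← Real.exp_mul]
  congr 3
  ring

theorem lintegral_enorm_rpow_sigma (μ : Measure (CSpace n)) (q : ℝ≥0) (f : CSpace n → ℂ) :
    ∫⁻ z, ‖f z‖ₑ ^ (q : ℝ) ∂(sigma α q μ) = ∫⁻ z, ‖weighted α f z‖ₑ ^ (q : ℝ) ∂μ := by
  rw [sigma, lintegral_withDensity_eq_lintegral_mul_non_measurable _ (by fun_prop)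
    (Filter.Eventually.of_forall fun _ => ENNReal.ofReal_lt_top)]
  refine lintegral_congr fun z => ?_
  rw [enorm_weighted_rpow, mul_comm]
  rfl

theorem absolutelyContinuous_sigma (μ : Measure (CSpace n)) (q : ℝ≥0) : μ ≪ sigma α q μ :=
  withDensity_absolutelyContinuous' (by fun_prop)
    (Filter.Eventually.of_forall fun _ => (ENNReal.ofReal_pos.2 (Real.exp_pos _)).ne')

theorem eLpNorm_sigma {q : ℝ≥0} (hq : q ≠ 0) (μ : Measure (CSpace n)) (f : CSpace n → ℂ) :
    eLpNorm f q (sigma α q μ) = eLpNorm (weighted α f) q μ := by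
  rw [eLpNorm_nnreal_eq_lintegral hq, eLpNorm_nnreal_eq_lintegral hq, lintegral_enorm_rpow_sigma]

theorem coe_pos_of_fact {p : ℝ≥0} [Fact (1 ≤ p)] : (0 : ℝ) < p := by
  exact_mod_cast zero_lt_one.trans_le (Fact.out : 1 ≤ p)

section

variable {p : ℝ≥0} [Fact (0 < α)] [Fact (1 ≤ p)]

variable (α p) in
/-- The normalized reproducing kernel `k_a(z) = K_a(z) e^{-α|a|²/2}`, as an element of `F^p_α`. -/
def coherentState (a : CSpace n) : FockSpace n α p :=
  ⟨coherentFun α a, differentiable_coherentFun a, by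
    have hα : 0 < α := Fact.out
    have hp : (0 : ℝ) < p := coe_pos_of_fact
    refine ⟨(continuous_weighted (differentiable_coherentFun a).continuous).aestronglyMeasurable,
      ?_⟩
    rw [eLpNorm_nnreal_eq_lintegral (by exact_mod_cast hp.ne')]
    refine ENNReal.rpow_lt_top_of_nonneg (by positivity) ?_
    simp_rw [enorm_weighted_coherentFun_rpow]
    rw [normalizedVolume, lintegral_smul_measure, lintegral_exp_neg_mul_sq_sub, smul_eq_mul]
    exact ENNReal.mul_ne_top ENNReal.ofReal_ne_top
      (lintegral_exp_neg_mul_sq_lt_top (by positivity)).ne⟩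

/-- The norm of `k_a` does not depend on `a`, by translation invariance of Lebesgue measure. -/
theorem enorm_coherentState (a : CSpace n) :
    ‖coherentState α p a‖ₑ = ‖coherentState α p (0 : CSpace n)‖ₑ := by
  have hp : (0 : ℝ) < p := coe_pos_of_fact
  have h : ∀ b : CSpace n, ∫⁻ z, ‖weighted α (coherentState α p b) z‖ₑ ^ (p : ℝ) =
      ∫⁻ z : CSpace n, ENNReal.ofReal (Real.exp (-(α / 2 * p) * ‖z‖ ^ 2)) := fun b => by
    rw [← lintegral_exp_neg_mul_sq_sub _ b]
    exact lintegral_congr fun z => enorm_weighted_coherentFun_rpow b z p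
  have h1 := (h a).trans (h 0).symm
  rw [lintegral_weighted_rpow, lintegral_weighted_rpow,
    ENNReal.mul_right_inj (ENNReal.inv_ne_zero.2 ENNReal.ofReal_ne_top)
      (ENNReal.inv_ne_top.2 (ENNReal.ofReal_pos.2 mass_pos).ne')] at h1
  exact ENNReal.rpow_left_injective hp.ne' h1

theorem nnnorm_coherentState (a : CSpace n) :
    ‖coherentState α p a‖₊ = ‖coherentState α p (0 : CSpace n)‖₊ := by
  have h := enorm_coherentState (α := α) (p := p) a
  rw [enorm_eq_nnnorm, enorm_eq_nnnorm] at h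
  exact_mod_cast h

variable {q : ℝ≥0} [Fact (1 ≤ q)]

theorem IsEmbedding.enorm_rpow {μ : Measure (CSpace n)}
    {J : FockSpace n α p →L[ℂ] Lp ℂ q (sigma α q μ)} (hJ : IsEmbedding μ J)
    (f : FockSpace n α p) :
    ‖J f‖ₑ ^ (q : ℝ) = ∫⁻ z, ‖weighted α f z‖ₑ ^ (q : ℝ) ∂μ := by
  have hq : (0 : ℝ) < q := coe_pos_of_fact
  rw [Lp.enorm_def, eLpNorm_congr_ae (hJ f), eLpNorm_sigma (by exact_mod_cast hq.ne'),
    eLpNorm_nnreal_eq_lintegral (by exact_mod_cast hq.ne'), ← ENNReal.rpow_mul, one_div,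
    inv_mul_cancel₀ hq.ne', ENNReal.rpow_one]

/-- A Carleson inequality for `μ` produces the embedding as a bounded operator. -/
theorem exists_isEmbedding {μ : Measure (CSpace n)} {C : ℝ≥0}
    (h : ∀ f : FockSpace n α p,
      ∫⁻ z, ‖weighted α f z‖ₑ ^ (q : ℝ) ∂μ ≤ C * ‖f‖ₑ ^ (q : ℝ)) :
    ∃ J : FockSpace n α p →L[ℂ] Lp ℂ q (sigma α q μ), IsEmbedding μ J := by
  have hq : (0 : ℝ) < q := coe_pos_of_fact
  have hle : ∀ f : FockSpace n α p, eLpNorm f q (sigma α q μ) ≤ (C ^ (q : ℝ)⁻¹ : ℝ≥0) * ‖f‖ₑ := by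
    intro f
    rw [eLpNorm_sigma (by exact_mod_cast hq.ne'),
      eLpNorm_nnreal_eq_lintegral (by exact_mod_cast hq.ne'), one_div]
    refine (ENNReal.rpow_le_rpow (h f) (by positivity)).trans_eq ?_
    rw [ENNReal.mul_rpow_of_nonneg _ _ (by positivity), ← ENNReal.rpow_mul,
      mul_inv_cancel₀ hq.ne', ENNReal.rpow_one, ENNReal.coe_rpow_of_nonneg _ (by positivity)]
  have hmem : ∀ f : FockSpace n α p, MemLp f q (sigma α q μ) := fun f =>
    ⟨f.2.1.continuous.aestronglyMeasurable,
      (hle f).trans_lt (ENNReal.mul_lt_top ENNReal.coe_lt_top enorm_lt_top)⟩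
  let L : FockSpace n α p →ₗ[ℂ] Lp ℂ q (sigma α q μ) :=
    { toFun := fun f => (hmem f).toLp f
      map_add' := fun f g => (MemLp.toLp_add (hmem f) (hmem g))
      map_smul' := fun c f => (MemLp.toLp_const_smul c (hmem f)) }
  refine ⟨L.mkContinuous (C ^ (q : ℝ)⁻¹ : ℝ≥0) fun f => ?_, fun f => (hmem f).coeFn_toLp⟩
  have h1 : ‖L f‖ₑ ≤ (C ^ (q : ℝ)⁻¹ : ℝ≥0) * ‖f‖ₑ := by
    have : ‖L f‖ₑ = eLpNorm f q (sigma α q μ) := Lp.enorm_toLp (hmem f)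
    exact this.trans_le (hle f)
  have h2 : ‖L f‖₊ ≤ (C ^ (q : ℝ)⁻¹ : ℝ≥0) * ‖f‖₊ := by
    rw [enorm_eq_nnnorm, enorm_eq_nnnorm] at h1
    exact_mod_cast h1
  exact_mod_cast h2

end

end Fock

/-! ### The Toeplitz integral on `L^p(σ_p)` -/

namespace GrowthFockSpace

variable {n : ℕ} {α : ℝ}

theorem norm_weighted_le (f : GrowthFockSpace n α) (z : CSpace n) :
    ‖Fock.weighted α f z‖ ≤ ‖f‖ :=
  (toBCF n α f).norm_coe_le_norm z

theorem norm_le {f : GrowthFockSpace n α} {C : ℝ} (hC : 0 ≤ C)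
    (h : ∀ z, ‖Fock.weighted α f z‖ ≤ C) : ‖f‖ ≤ C :=
  (BoundedContinuousFunction.norm_le (f := toBCF n α f) hC).2 h

end GrowthFockSpace

namespace Fock

variable {n : ℕ} {α : ℝ}

theorem norm_toeplitzIntegrand (f : CSpace n → ℂ) (z w : CSpace n) :
    ‖toeplitzIntegrand α f z w‖ =
      Real.exp (α / 2 * ‖z‖ ^ 2) * (‖weighted α f w‖ * Real.exp (-(α / 2) * ‖w - z‖ ^ 2)) := by
  have h := norm_kernel_mul_exp (α := α) w z
  rw [norm_sub_rev] at h
  have h1 : Real.exp (-α * ‖w‖ ^ 2) =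
      Real.exp (-(α / 2) * ‖w‖ ^ 2) * Real.exp (-(α / 2) * ‖w‖ ^ 2) := by
    rw [← Real.exp_add]; congr 1; ring
  have h2 : Real.exp (α / 2 * ‖z‖ ^ 2) * Real.exp (-(α / 2) * ‖z‖ ^ 2) = 1 := by
    rw [← Real.exp_add, ← add_mul]; simp
  rw [toeplitzIntegrand, norm_mul, norm_mul, Complex.norm_real, Real.norm_eq_abs, Real.abs_exp,
    norm_weighted, ← h, h1]
  linear_combination (-1 * ‖kernel α w z‖ * ‖f w‖ * Real.exp (-(α / 2) * ‖w‖ ^ 2) * Real.exp (-(α / 2) * ‖w‖ ^ 2)) * h2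

theorem aestronglyMeasurable_toeplitzIntegrand {μ : Measure (CSpace n)} {f : CSpace n → ℂ}
    (hf : AEStronglyMeasurable f μ) (z : CSpace n) :
    AEStronglyMeasurable (toeplitzIntegrand α f z) μ := by
  have h1 : Continuous fun w : CSpace n => (Real.exp (-α * ‖w‖ ^ 2) : ℂ) := by fun_prop
  exact ((continuous_kernel_left z).aestronglyMeasurable.mul hf).mul h1.aestronglyMeasurable

theorem lintegral_enorm_toeplitzIntegrand (μ : Measure (CSpace n)) (f : CSpace n → ℂ)
    (z : CSpace n) :
    ∫⁻ w, ‖toeplitzIntegrand α f z w‖ₑ ∂μ = ENNReal.ofReal (Real.exp (α / 2 * ‖z‖ ^ 2)) *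
      ∫⁻ w, ‖weighted α f w‖ₑ * ENNReal.ofReal (Real.exp (-(α / 2) * ‖w - z‖ ^ 2)) ∂μ := by
  rw [← lintegral_const_mul' _ _ ENNReal.ofReal_ne_top]
  refine lintegral_congr fun w => ?_
  rw [← ofReal_norm, norm_toeplitzIntegrand, ENNReal.ofReal_mul (Real.exp_pos _).le,
    ENNReal.ofReal_mul (norm_nonneg _), ofReal_norm]

theorem enorm_weighted_toeplitz_le (μ : Measure (CSpace n)) (f : CSpace n → ℂ) (z : CSpace n) :
    ‖weighted α (toeplitz α μ f) z‖ₑ ≤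
      ∫⁻ w, ‖weighted α f w‖ₑ * ENNReal.ofReal (Real.exp (-(α / 2) * ‖w - z‖ ^ 2)) ∂μ := by
  rw [← ofReal_norm, norm_weighted, ENNReal.ofReal_mul (norm_nonneg _), ofReal_norm, toeplitz]
  refine (mul_le_mul_left (enorm_integral_le_lintegral_enorm _) _).trans_eq ?_
  rw [lintegral_enorm_toeplitzIntegrand, mul_right_comm, ← ENNReal.ofReal_mul (Real.exp_pos _).le,
    ← Real.exp_add, ← add_mul]
  simp

/-- `T_μ f` is entire. Near `z₀` the `z`-derivative of the integrand is dominated because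
`e^{c|w|}` is absorbed by a quarter of the Gaussian weight. -/
theorem differentiable_toeplitz (hα : 0 < α) {μ : Measure (CSpace n)} {f : CSpace n → ℂ}
    (hf : AEStronglyMeasurable f μ)
    (hint : ∫⁻ w, ‖weighted α f w‖ₑ * ENNReal.ofReal (Real.exp (-(α / 4) * ‖w‖ ^ 2)) ∂μ < ∞) :
    Differentiable ℂ (toeplitz α μ f) := by
  intro z₀
  set c : ℝ := α * (‖z₀‖ + 1) + α with hc
  set K : ℝ := Real.exp (c ^ 2 / α) with hK
  set G : CSpace n → ℝ := fun w => ‖weighted α f w‖ * Real.exp (-(α / 4) * ‖w‖ ^ 2) with hG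
  have hWm : AEStronglyMeasurable (weighted α f) μ :=
    hf.mul (Continuous.aestronglyMeasurable (by fun_prop))
  have hGi : Integrable G μ := by
    refine ⟨hWm.norm.mul (Continuous.aestronglyMeasurable (by fun_prop)), ?_⟩
    refine (lintegral_congr fun w => ?_).trans_lt hint
    rw [hG, ← ofReal_norm, Real.norm_of_nonneg (by positivity), ENNReal.ofReal_mul (norm_nonneg _),
      ofReal_norm]
  have hdom : ∀ z ∈ ball z₀ 1, ∀ w,
      Real.exp (α * ‖w‖) * ‖toeplitzIntegrand α f z w‖ ≤ K * G w := by
    intro z hz w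
    have hzn : ‖z‖ ≤ ‖z₀‖ + 1 := by
      have h1 : ‖z - z₀‖ < 1 := by simpa [dist_eq_norm] using hz
      have := norm_le_norm_add_norm_sub' z z₀
      linarith
    have h1 : ‖kernel α w z‖ ≤ Real.exp (α * (‖z₀‖ + 1) * ‖w‖) := by
      rw [kernel, Complex.norm_exp]
      gcongr
      have h2 : (inner ℂ w z).re ≤ ‖w‖ * ‖z‖ :=
        (Complex.re_le_norm _).trans (norm_inner_le_norm w z)
      have h3 : ‖w‖ * ‖z‖ ≤ ‖w‖ * (‖z₀‖ + 1) := by gcongr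
      simp only [Complex.mul_re, Complex.ofReal_re, Complex.ofReal_im, zero_mul, sub_zero]
      nlinarith
    rw [toeplitzIntegrand, norm_mul, norm_mul, Complex.norm_real, Real.norm_eq_abs, Real.abs_exp,
      hG]
    simp only [norm_weighted]
    calc _ ≤ Real.exp (α * ‖w‖) * (Real.exp (α * (‖z₀‖ + 1) * ‖w‖) * ‖f w‖ *
          Real.exp (-α * ‖w‖ ^ 2)) := by gcongr
      _ = ‖f w‖ * Real.exp (α * ‖w‖ + α * (‖z₀‖ + 1) * ‖w‖ + -α * ‖w‖ ^ 2) := by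
        rw [Real.exp_add, Real.exp_add]; ring
      _ ≤ ‖f w‖ * Real.exp (c ^ 2 / α + -(α / 2) * ‖w‖ ^ 2 + -(α / 4) * ‖w‖ ^ 2) := by
        refine mul_le_mul_of_nonneg_left (Real.exp_le_exp.2 ?_) (norm_nonneg _)
        -- Completing the square absorbs `e^{c|w|}` in `e^{α|w|²/4}`.
        have h4 : c * ‖w‖ ≤ c ^ 2 / α + α / 4 * ‖w‖ ^ 2 := by
          have h5 : c ^ 2 / α + α / 4 * ‖w‖ ^ 2 - c * ‖w‖ = (c - α / 2 * ‖w‖) ^ 2 / α := by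
            field_simp; ring
          have h6 : 0 ≤ (c - α / 2 * ‖w‖) ^ 2 / α := by positivity
          linarith
        rw [hc] at h4 ⊢
        linarith
      _ = _ := by rw [Real.exp_add, Real.exp_add, hK]; ring
  have hdom' : ∀ z ∈ ball z₀ 1, ∀ w, ‖toeplitzIntegrand α f z w‖ ≤ K * G w := fun z hz w =>
    (le_mul_of_one_le_left (norm_nonneg _) (Real.one_le_exp (by positivity))).trans (hdom z hz w)
  let F' : CSpace n → CSpace n → CSpace n →L[ℂ] ℂ := fun z w =>
    ((α : ℂ) * toeplitzIntegrand α f z w) • innerSL ℂ w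
  have key : HasFDerivAt (fun z => ∫ w, toeplitzIntegrand α f z w ∂μ) (∫ w, F' z₀ w ∂μ) z₀ := by
    refine hasFDerivAt_integral_of_dominated_of_fderiv_le (bound := fun w => K * G w)
      (ball_mem_nhds z₀ one_pos)
      (Filter.Eventually.of_forall fun z => aestronglyMeasurable_toeplitzIntegrand hf z) ?_ ?_ ?_
      (hGi.const_mul K) ?_
    · exact (hGi.const_mul K).mono' (aestronglyMeasurable_toeplitzIntegrand hf z₀)
        (Filter.Eventually.of_forall fun w => hdom' z₀ (mem_ball_self one_pos) w)
    · exact ((aestronglyMeasurable_toeplitzIntegrand hf z₀).const_mul _).smul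
        (innerSL ℂ).continuous.aestronglyMeasurable
    · refine Filter.Eventually.of_forall fun w z hz => le_trans ?_ (hdom z hz w)
      rw [norm_smul, norm_mul, Complex.norm_real, Real.norm_of_nonneg hα.le, innerSL_apply_norm,
        mul_right_comm]
      gcongr
      linarith [Real.add_one_le_exp (α * ‖w‖)]
    · refine Filter.Eventually.of_forall fun w z _ => ?_
      have h1 : HasFDerivAt (fun z : CSpace n => inner ℂ w z) (innerSL ℂ w) z :=
        (innerSL ℂ w).hasFDerivAt
      have h2 := ((((h1.const_mul (α : ℂ)).cexp).mul_const (f w)).mul_const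
        (Real.exp (-α * ‖w‖ ^ 2) : ℂ))
      refine h2.congr_fderiv ?_
      ext v
      simp [F', toeplitzIntegrand, kernel]
      ring
  exact key.differentiableAt

/-- Hölder's inequality for the finite measure `e^{-β|w-z|²} dμ(w)`, which is at most `μ`. -/
theorem lintegral_enorm_weighted_mul_gaussian_le {β : ℝ} (hβ : 0 ≤ β) {q : ℝ≥0} (hq : 1 ≤ q)
    (μ : Measure (CSpace n)) {f : CSpace n → ℂ} (hf : AEStronglyMeasurable f μ) (z : CSpace n) :
    ∫⁻ w, ‖weighted α f w‖ₑ * ENNReal.ofReal (Real.exp (-β * ‖w - z‖ ^ 2)) ∂μ ≤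
      eLpNorm f q (sigma α q μ) *
        (∫⁻ w, ENNReal.ofReal (Real.exp (-β * ‖w - z‖ ^ 2)) ∂μ) ^ (1 - 1 / (q : ℝ)) := by
  have hq0 : q ≠ 0 := (zero_lt_one.trans_le hq).ne'
  have hWm : AEStronglyMeasurable (weighted α f) μ :=
    hf.mul (Continuous.aestronglyMeasurable (by fun_prop))
  set ρ : CSpace n → ℝ≥0∞ := fun w => ENNReal.ofReal (Real.exp (-β * ‖w - z‖ ^ 2))
  have hρ : Measurable ρ := by fun_prop
  set ν := μ.withDensity ρ
  have hν : ν ≤ μ := by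
    have h1 : ρ ≤ 1 := fun w => by
      refine ENNReal.ofReal_le_one.2 (Real.exp_le_one_iff.2 ?_)
      nlinarith [mul_nonneg hβ (sq_nonneg ‖w - z‖)]
    exact (withDensity_mono (Filter.Eventually.of_forall h1)).trans_eq withDensity_one
  have h := eLpNorm_le_eLpNorm_mul_rpow_measure_univ (μ := ν) (f := weighted α f) (p := 1)
    (q := q) (by exact_mod_cast hq) (hWm.mono_ac (withDensity_absolutelyContinuous _ _))
  rw [eLpNorm_one_eq_lintegral_enorm, withDensity_apply _ MeasurableSet.univ, setLIntegral_univ,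
    lintegral_withDensity_eq_lintegral_mul_non_measurable _ hρ
    (Filter.Eventually.of_forall fun _ => ENNReal.ofReal_lt_top)] at h
  rw [eLpNorm_sigma hq0]
  calc _ = ∫⁻ w, (ρ * fun w => ‖weighted α f w‖ₑ) w ∂μ := lintegral_congr fun w => mul_comm _ _
    _ ≤ _ := h
    _ ≤ _ := by
      simp only [ENNReal.toReal_one, ENNReal.coe_toReal, div_one]
      gcongr

variable {p : ℝ≥0} [Fact (0 < α)] [Fact (1 ≤ p)]

variable (n α) in
/-- The formula for `T_μ` defines a bounded operator from `L^p(σ_p)` to `F^∞_α`. -/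
theorem exists_lp_toeplitz {μ : Measure (CSpace n)} {M : ℝ≥0} (hM : UnitBallBound μ M) :
    ∃ P : Lp ℂ p (sigma α p μ) →L[ℂ] GrowthFockSpace n α, ∀ g z, P g z = toeplitz α μ g z := by
  have hα : 0 < α := Fact.out
  have hp : 1 ≤ p := Fact.out
  have hp' : 0 ≤ 1 - 1 / (p : ℝ) := by
    have : (1 : ℝ) ≤ p := by exact_mod_cast hp
    rw [sub_nonneg, div_le_one (by linarith)]
    exact this
  obtain ⟨C₂, h₂⟩ := exists_lintegral_gaussian_le n (half_pos hα)
  obtain ⟨C₄, h₄⟩ := exists_lintegral_gaussian_le n (by positivity : 0 < α / 4)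
  have hmeas : ∀ g : Lp ℂ p (sigma α p μ), AEStronglyMeasurable g μ := fun g =>
    (Lp.aestronglyMeasurable g).mono_ac (absolutelyContinuous_sigma μ p)
  set A : ℝ≥0 := (C₂ * M) ^ (1 - 1 / (p : ℝ))
  have hbd : ∀ (g : Lp ℂ p (sigma α p μ)) (z : CSpace n),
      ∫⁻ w, ‖weighted α g w‖ₑ * ENNReal.ofReal (Real.exp (-(α / 2) * ‖w - z‖ ^ 2)) ∂μ ≤
        A * ‖g‖ₑ := by
    intro g z
    refine (lintegral_enorm_weighted_mul_gaussian_le (half_pos hα).le hp μ (hmeas g) z).trans ?_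
    rw [← Lp.enorm_def, mul_comm, ENNReal.coe_rpow_of_nonneg _ hp', ENNReal.coe_mul]
    gcongr
    exact h₂ μ M hM z
  have hdiff : ∀ g : Lp ℂ p (sigma α p μ), Differentiable ℂ (toeplitz α μ g) := by
    intro g
    refine differentiable_toeplitz hα (hmeas g) ?_
    have h := lintegral_enorm_weighted_mul_gaussian_le (α := α) (by positivity : 0 ≤ α / 4) hp μ
      (hmeas g) 0
    simp only [sub_zero] at h
    refine h.trans_lt (ENNReal.mul_lt_top (Lp.eLpNorm_lt_top g)
      (ENNReal.rpow_lt_top_of_nonneg hp' ?_))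
    have := h₄ μ M hM 0
    simp only [sub_zero] at this
    exact (this.trans_lt (ENNReal.mul_lt_top ENNReal.coe_lt_top ENNReal.coe_lt_top)).ne
  have hi : ∀ (g : Lp ℂ p (sigma α p μ)) (z : CSpace n),
      Integrable (toeplitzIntegrand α g z) μ := by
    intro g z
    refine ⟨aestronglyMeasurable_toeplitzIntegrand (hmeas g) z, ?_⟩
    rw [HasFiniteIntegral, lintegral_enorm_toeplitzIntegrand]
    exact ENNReal.mul_lt_top ENNReal.ofReal_lt_top
      ((hbd g z).trans_lt (ENNReal.mul_lt_top ENNReal.coe_lt_top enorm_lt_top))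
  have hnorm : ∀ (g : Lp ℂ p (sigma α p μ)) (z : CSpace n),
      ‖weighted α (toeplitz α μ g) z‖ ≤ A * ‖g‖ := by
    intro g z
    have h1 := (enorm_weighted_toeplitz_le μ g z).trans (hbd g z)
    rw [enorm_eq_nnnorm, enorm_eq_nnnorm] at h1
    have h2 : ‖weighted α (toeplitz α μ g) z‖₊ ≤ A * ‖g‖₊ := by exact_mod_cast h1
    exact_mod_cast h2
  let L : Lp ℂ p (sigma α p μ) →ₗ[ℂ] GrowthFockSpace n α :=
    { toFun := fun g => ⟨toeplitz α μ g, hdiff g, _, hnorm g⟩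
      map_add' := fun g h => by
        refine Subtype.ext (funext fun z => ?_)
        change toeplitz α μ _ z = toeplitz α μ g z + toeplitz α μ h z
        rw [toeplitz, toeplitz, toeplitz, ← integral_add (hi g z) (hi h z)]
        refine integral_congr_ae ?_
        filter_upwards [(absolutelyContinuous_sigma μ p).ae_le (Lp.coeFn_add g h)] with w hw
        simp only [toeplitzIntegrand, hw, Pi.add_apply]
        ring
      map_smul' := fun c g => by
        refine Subtype.ext (funext fun z => ?_)
        change toeplitz α μ _ z = c * toeplitz α μ g z
        rw [toeplitz, toeplitz, ← integral_const_mul]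
        refine integral_congr_ae ?_
        filter_upwards [(absolutelyContinuous_sigma μ p).ae_le (Lp.coeFn_smul c g)] with w hw
        simp only [toeplitzIntegrand, hw, Pi.smul_apply, smul_eq_mul]
        ring }
  exact ⟨L.mkContinuous A fun g => GrowthFockSpace.norm_le (by positivity) (hnorm g),
    fun g z => rfl⟩

end Fock

/-! ### Compactness and decay of the measure of balls -/

namespace Fock

variable {n : ℕ} {α : ℝ}

theorem exp_mul_measure_ball_le {β : ℝ} (hβ : 0 ≤ β) (μ : Measure (CSpace n)) (a : CSpace n) :
    ENNReal.ofReal (Real.exp (-β)) * μ (ball a 1) ≤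
      ∫⁻ w, ENNReal.ofReal (Real.exp (-β * ‖w - a‖ ^ 2)) ∂μ := by
  rw [← setLIntegral_const]
  refine (setLIntegral_mono' measurableSet_ball fun w hw => ?_).trans (setLIntegral_le_lintegral _ _)
  have h1 : ‖w - a‖ < 1 := by simpa [dist_eq_norm] using hw
  gcongr
  have h2 : ‖w - a‖ ^ 2 ≤ 1 := by nlinarith [norm_nonneg (w - a)]
  nlinarith

theorem measure_ball_le {β : ℝ} (hβ : 0 ≤ β) (μ : Measure (CSpace n)) (a : CSpace n) :
    μ (ball a 1) ≤ ENNReal.ofReal (Real.exp β) *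
      ∫⁻ w, ENNReal.ofReal (Real.exp (-β * ‖w - a‖ ^ 2)) ∂μ := by
  have h := mul_le_mul_right (exp_mul_measure_ball_le hβ μ a) (ENNReal.ofReal (Real.exp β))
  rwa [← mul_assoc, ← ENNReal.ofReal_mul (Real.exp_pos _).le, ← Real.exp_add, add_neg_cancel,
    Real.exp_zero, ENNReal.ofReal_one, one_mul] at h

theorem unitBallBound_of_lintegral_gaussian_le {β : ℝ} (hβ : 0 ≤ β) {μ : Measure (CSpace n)}
    {C : ℝ≥0} (h : ∀ a, ∫⁻ w, ENNReal.ofReal (Real.exp (-β * ‖w - a‖ ^ 2)) ∂μ ≤ C) :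
    UnitBallBound μ (Real.toNNReal (Real.exp β) * C) := fun a => by
  refine (measure_ball_le hβ μ a).trans ?_
  rw [ENNReal.coe_mul]
  exact mul_le_mul_right (h a) _

theorem tendsto_measure_ball {β : ℝ} (hβ : 0 ≤ β) {μ : Measure (CSpace n)}
    (h : Tendsto (fun a => ∫⁻ w, ENNReal.ofReal (Real.exp (-β * ‖w - a‖ ^ 2)) ∂μ)
      (cocompact _) (𝓝 0)) :
    Tendsto (fun a => μ (ball a 1)) (cocompact _) (𝓝 0) := by
  refine tendsto_of_tendsto_of_tendsto_of_le_of_le tendsto_const_nhds ?_ (fun _ => zero_le)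
    (fun a => measure_ball_le hβ μ a)
  simpa using ENNReal.Tendsto.const_mul h (Or.inr ENNReal.ofReal_ne_top)

/-- Balls that meet the complement of a large ball are centred far away. -/
theorem exists_unitBallBound_restrict {μ : Measure (CSpace n)}
    (h : Tendsto (fun a => μ (ball a 1)) (cocompact _) (𝓝 0)) {η : ℝ≥0} (hη : 0 < η) :
    ∃ R : ℝ, UnitBallBound (μ.restrict (closedBall 0 R)ᶜ) η := by
  have h1 : ∀ᶠ a in cocompact (CSpace n), μ (ball a 1) ≤ η :=
    (h.eventually_lt_const (by exact_mod_cast hη)).mono fun _ => le_of_lt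
  obtain ⟨r, hr⟩ := closedBall_compl_subset_of_mem_cocompact h1 0
  refine ⟨r + 1, fun a => ?_⟩
  rw [Measure.restrict_apply measurableSet_ball]
  by_cases ha : a ∈ closedBall (0 : CSpace n) r
  · have h2 : ball a 1 ∩ (closedBall (0 : CSpace n) (r + 1))ᶜ = ∅ := by
      rw [← Set.sdiff_eq, Set.sdiff_eq_empty]
      refine ball_subset_closedBall.trans (closedBall_subset_closedBall' ?_)
      linarith [mem_closedBall.1 ha]
    simp [h2]
  · exact (measure_mono Set.inter_subset_left).trans (hr ha)

theorem isCountablyGenerated_cocompact : (cocompact (CSpace n)).IsCountablyGenerated := by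
  rw [← Metric.cobounded_eq_cocompact, ← comap_norm_atTop]
  infer_instance

theorem tendsto_exp_neg_mul_sq_sub {β : ℝ} (hβ : 0 < β) (z : CSpace n) :
    Tendsto (fun a => Real.exp (-β * ‖z - a‖ ^ 2)) (cocompact (CSpace n)) (𝓝 0) := by
  have h1 : Tendsto (fun a : CSpace n => ‖z - a‖) (cocompact _) atTop :=
    (tendsto_dist_left_cocompact_atTop z).congr fun a => dist_eq_norm z a
  have h2 : Tendsto (fun a : CSpace n => -β * ‖z - a‖ ^ 2) (cocompact _) atBot :=
    ((tendsto_pow_atTop two_ne_zero).comp h1).const_mul_atTop_of_neg (neg_neg_of_pos hβ)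
  exact Real.tendsto_exp_atBot.comp h2

/-- A compact operator sends a bounded family to a family tending to `0`, once `0` is the only
possible limit along sequences. -/
theorem tendsto_zero_of_isCompactOperator {X Y ι : Type*} [NormedAddCommGroup X] [NormedSpace ℂ X]
    [NormedAddCommGroup Y] [NormedSpace ℂ Y] {S : X →L[ℂ] Y} (hS : IsCompactOperator S)
    {l : Filter ι} [l.IsCountablyGenerated] {k : ι → X} {C : ℝ} (hk : ∀ a, ‖k a‖ ≤ C)
    (h0 : ∀ (u : ℕ → ι) (y : Y), Tendsto u atTop l → Tendsto (fun i => S (k (u i))) atTop (𝓝 y) →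
      y = 0) :
    Tendsto (fun a => S (k a)) l (𝓝 0) := by
  obtain ⟨K, hK, hSK⟩ := hS.image_closedBall_subset_compact C
  refine tendsto_of_subseq_tendsto fun u hu => ?_
  obtain ⟨y, -, φ, hφ, hy⟩ := hK.tendsto_subseq (x := fun i => S (k (u i)))
    fun i => hSK ⟨k (u i), by simpa using hk (u i), rfl⟩
  have := h0 (u ∘ φ) y (hu.comp hφ.tendsto_atTop) hy
  exact ⟨φ, this ▸ hy⟩

/-- Montel: on a closed ball, the unit ball of `F^p_α` has finite nets for the uniform distance. -/
theorem exists_finite_net (α : ℝ) (p : ℝ≥0) [Fact (0 < α)] [Fact (1 ≤ p)] (R : ℝ) {δ : ℝ}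
    (hδ : 0 < δ) :
    ∃ t ⊆ closedBall (0 : FockSpace n α p) 1, t.Finite ∧ ∀ f ∈ closedBall (0 : FockSpace n α p) 1,
      ∃ g ∈ t, ∀ z ∈ closedBall (0 : CSpace n) R, ‖f z - g z‖ < δ := by
  have hα : 0 < α := Fact.out
  obtain ⟨C, hC⟩ := exists_enorm_weighted_le n α p
  set B : ℝ := C * Real.exp (α / 2 * (R + 1) ^ 2) with hB
  have hbd : ∀ f ∈ closedBall (0 : FockSpace n α p) 1, ∀ z : CSpace n, ‖z‖ ≤ R + 1 →
      ‖f z‖ ≤ B := by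
    intro f hf z hz
    have hf1 : ‖f‖ ≤ 1 := by simpa using hf
    have h1 := hC f z
    rw [enorm_eq_nnnorm, enorm_eq_nnnorm] at h1
    have h2 : ‖weighted α f z‖ ≤ C * ‖f‖ := by
      have : ‖weighted α f z‖₊ ≤ C * ‖f‖₊ := by exact_mod_cast h1
      exact_mod_cast this
    have h3 : ‖weighted α f z‖ ≤ C := h2.trans (mul_le_of_le_one_right C.2 hf1)
    rw [norm_weighted] at h3
    have h4 : ‖f z‖ = ‖f z‖ * Real.exp (-(α / 2) * ‖z‖ ^ 2) * Real.exp (α / 2 * ‖z‖ ^ 2) := by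
      rw [mul_assoc, ← Real.exp_add, ← add_mul]; simp
    rw [h4, hB]
    gcongr
  let Φ : FockSpace n α p → BoundedContinuousFunction (closedBall (0 : CSpace n) R) ℂ := fun f =>
    BoundedContinuousFunction.mkOfCompact ⟨fun z => f z, f.2.1.continuous.comp continuous_subtype_val⟩
  have hAA : IsCompact (closure (Φ '' closedBall 0 1)) := by
    refine BoundedContinuousFunction.arzela_ascoli (closedBall 0 B) (isCompact_closedBall 0 B) _ ?_ ?_
    · rintro _ z ⟨f, hf, rfl⟩
      have hz : ‖(z : CSpace n)‖ ≤ R := mem_closedBall_zero_iff.1 z.2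
      exact mem_closedBall_zero_iff.2 (hbd f hf z (by linarith))
    · intro x
      rw [Metric.equicontinuousAt_iff]
      intro ε hε
      have hx : ‖(x : CSpace n)‖ ≤ R := mem_closedBall_zero_iff.1 x.2
      have hB0 : 0 ≤ B := by positivity
      refine ⟨min 1 (ε / (2 * B + 1)), by positivity, ?_⟩
      rintro y hy ⟨_, f, hf, rfl⟩
      change dist (f x) (f y) < ε
      have hy1 : dist (y : CSpace n) x < 1 := hy.trans_le (min_le_left _ _)
      have hy2 : dist (y : CSpace n) x < ε / (2 * B + 1) := hy.trans_le (min_le_right _ _)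
      have hmaps : Set.MapsTo f (ball (x : CSpace n) 1) (closedBall (f x) (2 * B)) := by
        intro w hw
        have hw' : ‖w - x‖ < 1 := by simpa [dist_eq_norm] using hw
        have hwn : ‖w‖ ≤ R + 1 := by
          have := norm_le_norm_add_norm_sub' w (x : CSpace n)
          linarith
        rw [mem_closedBall, dist_eq_norm]
        have := norm_sub_le (f w) (f x)
        have := hbd f hf w hwn
        have := hbd f hf x (by linarith)
        linarith
      -- The Schwarz lemma bounds the oscillation of `f` near `x` uniformly in `f`.
      have h := Complex.dist_le_div_mul_dist_of_mapsTo_ball f.2.1.differentiableOn hmaps hy1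
      rw [dist_comm]
      rw [lt_div_iff₀ (by positivity)] at hy2
      rw [div_one] at h
      have := dist_nonneg (x := (y : CSpace n)) (y := x)
      change dist (f y) (f x) ≤ _ at h
      nlinarith
  have htb : TotallyBounded (Φ '' closedBall 0 1) := hAA.totallyBounded.subset subset_closure
  obtain ⟨s, hsub, hsf, hs⟩ := totallyBounded_iff_subset.1 htb _ (dist_mem_uniformity hδ)
  choose! sec hsec using fun y (hy : y ∈ s) => hsub hy
  refine ⟨sec '' s, ?_, hsf.image _, fun f hf => ?_⟩
  · rintro _ ⟨y, hy, rfl⟩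
    exact (hsec y hy).1
  · obtain ⟨y, hy, hfy⟩ := Set.mem_iUnion₂.1 (hs ⟨f, hf, rfl⟩)
    refine ⟨sec y, ⟨y, hy, rfl⟩, fun z hz => ?_⟩
    have h1 : dist (Φ f) (Φ (sec y)) < δ := by
      rw [(hsec y hy).2]; exact hfy
    have h2 := (BoundedContinuousFunction.dist_coe_le_dist (f := Φ f) (g := Φ (sec y))
      ⟨z, hz⟩).trans_lt h1
    rwa [dist_eq_norm] at h2

variable {p q : ℝ≥0} [Fact (0 < α)] [Fact (1 ≤ p)] [Fact (1 ≤ q)]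

/-- If `μ(B(a,1)) → 0`, the embedding maps the unit ball to a totally bounded set: a finite net for
the uniform distance on a large closed ball is a net in `L^q(σ_q)`, since the Carleson inequality
for `μ` restricted to the complement makes the remaining part of the norm small. -/
theorem isCompactOperator_of_tendsto_measure_ball (hpq : p ≤ q) {μ : Measure (CSpace n)} {M : ℝ≥0}
    (hM : UnitBallBound μ M) (hV : Tendsto (fun a => μ (ball a 1)) (cocompact _) (𝓝 0))
    {J : FockSpace n α p →L[ℂ] Lp ℂ q (sigma α q μ)} (hJ : IsEmbedding μ J) :
    IsCompactOperator J := by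
  have hα : 0 < α := Fact.out
  have hq : (0 : ℝ) < q := coe_pos_of_fact
  have := hM.isLocallyFiniteMeasure
  obtain ⟨C, hC⟩ := exists_lintegral_weighted_rpow_le n α p hpq
  suffices h : TotallyBounded (J '' closedBall 0 1) from
    (isCompactOperator_iff_isCompact_closure_image_closedBall J.toLinearMap one_pos).2
      (isCompact_iff_totallyBounded_isComplete.2 ⟨h.closure, isClosed_closure.isComplete⟩)
  rw [EMetric.totallyBounded_iff]
  intro ε hε
  have hε0 : ε ^ (q : ℝ) / 2 ≠ 0 := by
    simp [ENNReal.div_eq_zero_iff, ENNReal.rpow_eq_zero_iff, hε.ne', hq, hq.not_gt]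
  obtain ⟨η, hη, hη'⟩ := ENNReal.exists_nnreal_pos_mul_lt (a := C * 2 ^ (q : ℝ))
    (ENNReal.mul_ne_top ENNReal.coe_ne_top (ENNReal.rpow_ne_top_of_nonneg hq.le (by simp))) hε0
  obtain ⟨R, hR⟩ := exists_unitBallBound_restrict hV hη
  obtain ⟨δ, hδ, hδ'⟩ := ENNReal.exists_nnreal_pos_mul_lt
    ((isCompact_closedBall (0 : CSpace n) R).measure_lt_top (μ := μ)).ne hε0
  have hδ0 : (0 : ℝ) < (δ ^ (q : ℝ)⁻¹ : ℝ≥0) := by exact_mod_cast NNReal.rpow_pos hδ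
  obtain ⟨t, ht, htf, hnet⟩ := exists_finite_net (n := n) α p R hδ0
  refine ⟨J '' t, htf.image _, ?_⟩
  rintro _ ⟨f, hf, rfl⟩
  obtain ⟨g, hg, hfg⟩ := hnet f hf
  refine Set.mem_iUnion₂.2 ⟨J g, ⟨g, hg, rfl⟩, ?_⟩
  change edist (J f) (J g) < ε
  rw [edist_eq_enorm_sub, ← map_sub, ← ENNReal.rpow_lt_rpow_iff hq, hJ.enorm_rpow,
    ← lintegral_add_compl _ (measurableSet_closedBall (x := (0 : CSpace n)) (ε := R)),
    ← ENNReal.add_halves (ε ^ (q : ℝ))]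
  refine ENNReal.add_lt_add ?_ ?_
  · refine lt_of_le_of_lt ?_ hδ'
    rw [← setLIntegral_const]
    refine setLIntegral_mono' measurableSet_closedBall fun z hz => ?_
    rw [← ENNReal.le_rpow_inv_iff hq, ← ENNReal.coe_rpow_of_nonneg _ (by positivity)]
    have h1 : ‖weighted α (f - g : FockSpace n α p) z‖ ≤ ‖f z - g z‖ := by
      rw [norm_weighted]
      refine mul_le_of_le_one_right (norm_nonneg _) (Real.exp_le_one_iff.2 ?_)
      nlinarith [mul_nonneg hα.le (sq_nonneg ‖z‖)]
    have h2 : ‖weighted α (f - g : FockSpace n α p) z‖₊ ≤ δ ^ (q : ℝ)⁻¹ :=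
      h1.trans (hfg z hz).le
    rw [enorm_eq_nnnorm]
    exact_mod_cast h2
  · refine lt_of_le_of_lt ((hC _ _ hR (f - g)).trans ?_) hη'
    have h1 : ‖f - g‖ ≤ 2 := by
      have h2 : ‖f‖ ≤ 1 := by simpa using hf
      have h3 : ‖g‖ ≤ 1 := by simpa using ht hg
      linarith [norm_sub_le f g]
    have h2 : ‖f - g‖ₑ ≤ 2 := by
      rw [← ofReal_norm]
      exact ENNReal.ofReal_le_of_le_toReal (by simpa using h1)
    calc C * η * ‖f - g‖ₑ ^ (q : ℝ) ≤ C * η * 2 ^ (q : ℝ) := by gcongr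
      _ = η * (C * 2 ^ (q : ℝ)) := by ring

theorem tendsto_coherentFun (z : CSpace n) :
    Tendsto (fun a => coherentFun α a z) (cocompact (CSpace n)) (𝓝 0) := by
  have hα : 0 < α := Fact.out
  rw [tendsto_zero_iff_norm_tendsto_zero]
  have h := (tendsto_exp_neg_mul_sq_sub (half_pos hα) z).mul_const (Real.exp (α / 2 * ‖z‖ ^ 2))
  rw [zero_mul] at h
  refine h.congr fun a => ?_
  rw [← norm_weighted_coherentFun, norm_weighted, mul_assoc, ← Real.exp_add, ← add_mul]
  simp

/-- If the embedding is compact, then the images of the normalized kernels tend to `0`, since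
these kernels tend to `0` pointwise. -/
theorem tendsto_measure_ball_of_isCompactOperator {μ : Measure (CSpace n)}
    {J : FockSpace n α p →L[ℂ] Lp ℂ q (sigma α q μ)} (hJ : IsEmbedding μ J)
    (hc : IsCompactOperator J) : Tendsto (fun a => μ (ball a 1)) (cocompact _) (𝓝 0) := by
  have hα : 0 < α := Fact.out
  have hq : (0 : ℝ) < q := coe_pos_of_fact
  have hlim : Tendsto (fun a => J (coherentState α p a)) (cocompact (CSpace n)) (𝓝 0) := by
    have := isCountablyGenerated_cocompact (n := n)
    refine tendsto_zero_of_isCompactOperator hc (C := ‖coherentState α p (0 : CSpace n)‖)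
      (fun a => (congrArg NNReal.toReal (nnnorm_coherentState a)).le) fun u y hu hy => ?_
    -- A limit in `L^q` is an a.e. limit along a subsequence, hence equals the pointwise limit `0`.
    obtain ⟨ns, hns, hae⟩ := (tendstoInMeasure_of_tendsto_Lp hy).exists_seq_tendsto_ae
    have hall : ∀ᵐ z ∂(sigma α q μ), ∀ i, J (coherentState α p (u i)) z =
        coherentFun α (u i) z := ae_all_iff.2 fun i => hJ (coherentState α p (u i))
    refine Lp.eq_zero_iff_ae_eq_zero.2 ?_
    filter_upwards [hae, hall] with z hz hz'
    simp only [hz'] at hz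
    exact tendsto_nhds_unique hz ((tendsto_coherentFun z).comp (hu.comp hns.tendsto_atTop))
  refine tendsto_measure_ball (β := α / 2 * q) (by positivity) ?_
  have h1 := (ENNReal.continuous_rpow_const (y := (q : ℝ))).tendsto _ |>.comp hlim.enorm
  rw [enorm_zero, ENNReal.zero_rpow_of_pos hq] at h1
  refine h1.congr fun a => ?_
  rw [Function.comp_apply, hJ.enorm_rpow]
  exact lintegral_congr fun z => enorm_weighted_coherentFun_rpow a z q

end Fock

/-! ### Toeplitz operators with admissible symbols -/

namespace Fock

variable {n : ℕ} {α : ℝ}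

theorem norm_kernel_sq_mul_exp (w z : CSpace n) :
    ‖kernel α w z‖ ^ 2 * Real.exp (-α * ‖w‖ ^ 2) =
      Real.exp (α * ‖z‖ ^ 2) * Real.exp (-α * ‖w - z‖ ^ 2) := by
  have h := norm_kernel_mul_exp (α := α) w z
  have h1 : ∀ t : ℝ, Real.exp (-α * t) = Real.exp (-(α / 2) * t) ^ 2 := fun t => by
    rw [← Real.exp_nat_mul]; congr 1; push_cast; ring
  have h2 : Real.exp (α * ‖z‖ ^ 2) * Real.exp (-α * ‖z‖ ^ 2) = 1 := by
    rw [← Real.exp_add, ← add_mul]; simp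
  rw [h1] at h2
  rw [h1, h1, ← norm_sub_rev z w, ← h]
  linear_combination (-1 * ‖kernel α w z‖ ^ 2 * Real.exp (-(α / 2) * ‖w‖ ^ 2) ^ 2) * h2

theorem Admissible.lintegral_gaussian_lt_top {μ : Measure (CSpace n)} (hμ : Admissible α μ)
    (z : CSpace n) : ∫⁻ w, ENNReal.ofReal (Real.exp (-α * ‖w - z‖ ^ 2)) ∂μ < ∞ := by
  have h := hμ z
  simp_rw [norm_kernel_sq_mul_exp, ENNReal.ofReal_mul (Real.exp_pos _).le] at h
  rw [lintegral_const_mul' _ _ ENNReal.ofReal_ne_top] at h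
  exact ENNReal.lt_top_of_mul_ne_top_right h.ne
    (ENNReal.ofReal_pos.2 (Real.exp_pos _)).ne'

theorem inToeplitzDomain_of_lintegral_lt_top {μ : Measure (CSpace n)} {f : CSpace n → ℂ}
    (hf : Continuous f) (h : ∀ z, ∫⁻ w, ‖weighted α f w‖ₑ *
      ENNReal.ofReal (Real.exp (-(α / 2) * ‖w - z‖ ^ 2)) ∂μ < ∞) :
    InToeplitzDomain α μ f := fun z => by
  refine ⟨aestronglyMeasurable_toeplitzIntegrand hf.aestronglyMeasurable z, ?_⟩
  rw [HasFiniteIntegral, lintegral_enorm_toeplitzIntegrand]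
  exact ENNReal.mul_lt_top ENNReal.ofReal_lt_top (h z)

theorem enorm_weighted_coherentFun (a z : CSpace n) :
    ‖weighted α (coherentFun α a) z‖ₑ = ENNReal.ofReal (Real.exp (-(α / 2) * ‖z - a‖ ^ 2)) := by
  rw [← ofReal_norm, norm_weighted_coherentFun]

/-- The kernels belong to the domain of `T_μ`: the integrand is dominated by the two Gaussians that
admissibility controls at `a` and `z`, by `2xy ≤ x² + y²`. -/
theorem Admissible.inToeplitzDomain_coherentFun {μ : Measure (CSpace n)} (hμ : Admissible α μ)
    (a : CSpace n) : InToeplitzDomain α μ (coherentFun α a) := by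
  refine inToeplitzDomain_of_lintegral_lt_top (differentiable_coherentFun a).continuous fun z => ?_
  refine lt_of_le_of_lt (lintegral_mono (g := fun w =>
    ENNReal.ofReal (Real.exp (-α * ‖w - a‖ ^ 2)) + ENNReal.ofReal (Real.exp (-α * ‖w - z‖ ^ 2)))
    fun w => ?_) ?_
  · have h1 : ∀ t : ℝ, Real.exp (-α * t) = Real.exp (-(α / 2) * t) ^ 2 := fun t => by
      rw [← Real.exp_nat_mul]; congr 1; push_cast; ring
    simp only [enorm_weighted_coherentFun]
    rw [← ENNReal.ofReal_mul (Real.exp_pos _).le,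
      ← ENNReal.ofReal_add (Real.exp_pos _).le (Real.exp_pos _).le, h1, h1]
    refine ENNReal.ofReal_le_ofReal ?_
    nlinarith [sq_nonneg (Real.exp (-(α / 2) * ‖w - a‖ ^ 2) - Real.exp (-(α / 2) * ‖w - z‖ ^ 2)),
      sq_nonneg (Real.exp (-(α / 2) * ‖w - a‖ ^ 2) + Real.exp (-(α / 2) * ‖w - z‖ ^ 2))]
  · rw [lintegral_add_left (by fun_prop)]
    exact ENNReal.add_lt_top.2 ⟨hμ.lintegral_gaussian_lt_top a, hμ.lintegral_gaussian_lt_top z⟩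

/-- The Berezin transform of `μ` at `a`, as the weighted value at `a` of `T_μ k_a`. -/
theorem Admissible.enorm_weighted_toeplitz_coherentFun {μ : Measure (CSpace n)}
    (hμ : Admissible α μ) (a : CSpace n) :
    ‖weighted α (toeplitz α μ (coherentFun α a)) a‖ₑ =
      ∫⁻ w, ENNReal.ofReal (Real.exp (-α * ‖w - a‖ ^ 2)) ∂μ := by
  have hint : Integrable (fun w => Real.exp (-α * ‖w - a‖ ^ 2)) μ := by
    refine ⟨Continuous.aestronglyMeasurable (by fun_prop), ?_⟩
    refine (lintegral_congr fun w => ?_).trans_lt (hμ.lintegral_gaussian_lt_top a)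
    rw [← ofReal_norm, Real.norm_of_nonneg (Real.exp_pos _).le]
  have hpt : ∀ w, toeplitzIntegrand α (coherentFun α a) a w * (Real.exp (-(α / 2) * ‖a‖ ^ 2) : ℂ) =
      (Real.exp (-α * ‖w - a‖ ^ 2) : ℝ) := by
    intro w
    have h1 : kernel α a w = (starRingEnd ℂ) (kernel α w a) := by
      rw [kernel, kernel, ← Complex.exp_conj]
      simp
    have h2 : kernel α w a * kernel α a w = ((‖kernel α w a‖ ^ 2 : ℝ) : ℂ) := by
      rw [h1, Complex.mul_conj, Complex.normSq_eq_norm_sq]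
    have h3 : Real.exp (α * ‖a‖ ^ 2) * (Real.exp (-(α / 2) * ‖a‖ ^ 2) *
        Real.exp (-(α / 2) * ‖a‖ ^ 2)) = 1 := by
      rw [← Real.exp_add, ← Real.exp_add, Real.exp_eq_one_iff]; ring
    calc _ = (kernel α w a * kernel α a w) * (Real.exp (-α * ‖w‖ ^ 2) : ℂ) *
          ((Real.exp (-(α / 2) * ‖a‖ ^ 2) : ℂ) * (Real.exp (-(α / 2) * ‖a‖ ^ 2) : ℂ)) := by
            rw [toeplitzIntegrand, coherentFun]; ring
      _ = ((‖kernel α w a‖ ^ 2 * Real.exp (-α * ‖w‖ ^ 2) *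
          (Real.exp (-(α / 2) * ‖a‖ ^ 2) * Real.exp (-(α / 2) * ‖a‖ ^ 2)) : ℝ) : ℂ) := by
            rw [h2]; push_cast; ring
      _ = _ := by
            rw [norm_kernel_sq_mul_exp, mul_right_comm, h3, one_mul]
  rw [weighted, toeplitz, ← integral_mul_const]
  simp_rw [hpt]
  rw [integral_complex_ofReal, ← ofReal_norm, Complex.norm_real,
    Real.norm_of_nonneg (integral_nonneg fun _ => (Real.exp_pos _).le),
    ofReal_integral_eq_lintegral_ofReal hint (Eventually.of_forall fun _ => (Real.exp_pos _).le)]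

variable {p q : ℝ≥0} [Fact (0 < α)] [Fact (1 ≤ p)]

variable (n α p) in
/-- The domain and norm estimate: `|f|` is replaced by its weighted supremum, and what remains is a
Gaussian integral of `μ`. -/
theorem exists_toeplitz_bound :
    ∃ C : ℝ≥0, ∀ (μ : Measure (CSpace n)) (M : ℝ≥0), UnitBallBound μ M →
      (∀ f : FockSpace n α p, InToeplitzDomain α μ f) ∧
      ∀ (f : FockSpace n α p) z, ‖weighted α (toeplitz α μ f) z‖ ≤ C * M * ‖f‖ := by
  have hα : 0 < α := Fact.out
  obtain ⟨C₁, h₁⟩ := exists_enorm_weighted_le n α p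
  obtain ⟨C₂, h₂⟩ := exists_lintegral_gaussian_le n (half_pos hα)
  have hbd : ∀ (μ : Measure (CSpace n)) (M : ℝ≥0), UnitBallBound μ M →
      ∀ (f : FockSpace n α p) z, ∫⁻ w, ‖weighted α f w‖ₑ *
        ENNReal.ofReal (Real.exp (-(α / 2) * ‖w - z‖ ^ 2)) ∂μ ≤ (C₁ * C₂ * M * ‖f‖₊ : ℝ≥0) := by
    intro μ M hM f z
    calc _ ≤ ∫⁻ w, (C₁ * ‖f‖ₑ) * ENNReal.ofReal (Real.exp (-(α / 2) * ‖w - z‖ ^ 2)) ∂μ := by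
          gcongr with w
          exact h₁ f w
      _ ≤ (C₁ * ‖f‖ₑ) * (C₂ * M) := by
          rw [lintegral_const_mul _ (by fun_prop)]
          gcongr
          exact h₂ μ M hM z
      _ = _ := by
          rw [enorm_eq_nnnorm]; push_cast; ring
  refine ⟨C₁ * C₂, fun μ M hM => ⟨fun f => inToeplitzDomain_of_lintegral_lt_top f.2.1.continuous
    fun z => (hbd μ M hM f z).trans_lt ENNReal.coe_lt_top, fun f z => ?_⟩⟩
  have h := (enorm_weighted_toeplitz_le μ f z).trans (hbd μ M hM f z)
  rw [enorm_eq_nnnorm] at h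
  have h' : ‖weighted α (toeplitz α μ f) z‖₊ ≤ C₁ * C₂ * M * ‖f‖₊ := by exact_mod_cast h
  exact_mod_cast h'

/-- `T_μ` factors through `L^p(σ_p)`; this is also how it inherits compactness. -/
theorem UnitBallBound.exists_isToeplitz_comp {μ : Measure (CSpace n)} {M : ℝ≥0}
    (hM : UnitBallBound μ M) {J : FockSpace n α p →L[ℂ] Lp ℂ p (sigma α p μ)}
    (hJ : IsEmbedding μ J) :
    ∃ P : Lp ℂ p (sigma α p μ) →L[ℂ] GrowthFockSpace n α, IsToeplitz μ (P.comp J) := by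
  obtain ⟨P, hP⟩ := exists_lp_toeplitz n α (p := p) hM
  refine ⟨P, fun f _ z => ?_⟩
  rw [ContinuousLinearMap.comp_apply, hP, toeplitz, toeplitz]
  refine integral_congr_ae ?_
  filter_upwards [(absolutelyContinuous_sigma μ p).ae_le (hJ f)] with w hw
  simp only [toeplitzIntegrand, hw]

theorem UnitBallBound.exists_isEmbedding [Fact (1 ≤ q)] (hpq : p ≤ q) {μ : Measure (CSpace n)}
    {M : ℝ≥0} (hM : UnitBallBound μ M) :
    ∃ J : FockSpace n α p →L[ℂ] Lp ℂ q (sigma α q μ), IsEmbedding μ J := by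
  obtain ⟨C, hC⟩ := exists_lintegral_weighted_rpow_le n α p hpq
  exact Fock.exists_isEmbedding (C := C * M) fun f => by simpa using hC μ M hM f

/-- The Berezin transform of `μ` is bounded by the norms of `T k_a`. -/
theorem IsToeplitz.lintegral_gaussian_le {μ : Measure (CSpace n)} (hμ : Admissible α μ)
    {T : FockSpace n α p →L[ℂ] GrowthFockSpace n α} (hT : IsToeplitz μ T) (a : CSpace n) :
    ∫⁻ w, ENNReal.ofReal (Real.exp (-α * ‖w - a‖ ^ 2)) ∂μ ≤ ‖T (coherentState α p a)‖ₑ := by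
  have h1 : (T (coherentState α p a) : CSpace n → ℂ) = toeplitz α μ (coherentFun α a) :=
    funext fun z => hT (coherentState α p a) (hμ.inToeplitzDomain_coherentFun a) z
  rw [← hμ.enorm_weighted_toeplitz_coherentFun, ← h1, ← ofReal_norm, ← ofReal_norm]
  exact ENNReal.ofReal_le_ofReal (GrowthFockSpace.norm_weighted_le _ a)

theorem IsToeplitz.unitBallBound {μ : Measure (CSpace n)} (hμ : Admissible α μ)
    {T : FockSpace n α p →L[ℂ] GrowthFockSpace n α} (hT : IsToeplitz μ T) :
    UnitBallBound μ (Real.toNNReal (Real.exp α) *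
      (‖T‖₊ * ‖coherentState α p (0 : CSpace n)‖₊)) := by
  have hα : 0 < α := Fact.out
  refine unitBallBound_of_lintegral_gaussian_le hα.le fun a =>
    (hT.lintegral_gaussian_le hμ a).trans ?_
  rw [enorm_eq_nnnorm, ENNReal.coe_le_coe, ← nnnorm_coherentState a]
  exact T.le_opNNNorm _

theorem unitBallBound_of_carleson {C : ℝ≥0} {μ : Measure (CSpace n)}
    (h : ∀ f : FockSpace n α p, ∫⁻ z, ‖weighted α f z‖ₑ ^ (q : ℝ) ∂μ ≤ C * ‖f‖ₑ ^ (q : ℝ)) :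
    UnitBallBound μ (Real.toNNReal (Real.exp (α / 2 * q)) *
      (C * ‖coherentState α p (0 : CSpace n)‖₊ ^ (q : ℝ))) := by
  have hα : 0 < α := Fact.out
  refine unitBallBound_of_lintegral_gaussian_le (by positivity) fun a => ?_
  have h1 := h (coherentState α p a)
  rw [enorm_eq_nnnorm, nnnorm_coherentState] at h1
  rw [ENNReal.coe_mul, ENNReal.coe_rpow_of_nonneg _ q.coe_nonneg]
  refine le_trans (le_of_eq ?_) h1
  exact lintegral_congr fun z => (enorm_weighted_coherentFun_rpow a z q).symm

theorem IsEmbedding.carleson [Fact (1 ≤ q)] {μ : Measure (CSpace n)}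
    {J : FockSpace n α p →L[ℂ] Lp ℂ q (sigma α q μ)} (hJ : IsEmbedding μ J)
    (f : FockSpace n α p) :
    ∫⁻ z, ‖weighted α f z‖ₑ ^ (q : ℝ) ∂μ ≤ (‖J‖₊ ^ (q : ℝ) : ℝ≥0) * ‖f‖ₑ ^ (q : ℝ) := by
  rw [← hJ.enorm_rpow, ENNReal.coe_rpow_of_nonneg _ q.coe_nonneg,
    ← ENNReal.mul_rpow_of_nonneg _ _ q.coe_nonneg]
  refine ENNReal.rpow_le_rpow ?_ q.coe_nonneg
  rw [enorm_eq_nnnorm, enorm_eq_nnnorm]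
  exact_mod_cast J.le_opNNNorm f

/-- The Fock–Carleson property in terms of `weighted`, with a constant that is nonnegative. -/
theorem isFockCarleson_iff {μ : Measure (CSpace n)} :
    IsFockCarleson α p q μ ↔ ∃ C : ℝ≥0, ∀ f : FockSpace n α p,
      ∫⁻ z, ‖weighted α f z‖ₑ ^ (q : ℝ) ∂μ ≤ C * ‖f‖ₑ ^ (q : ℝ) := by
  have h1 : ∀ f : FockSpace n α p,
      ∫⁻ z, ENNReal.ofReal (‖f z‖ ^ (q : ℝ) * Real.exp (-(α * q / 2) * ‖z‖ ^ 2)) ∂μ =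
        ∫⁻ z, ‖weighted α f z‖ₑ ^ (q : ℝ) ∂μ := fun f => lintegral_congr fun z => by
    rw [enorm_weighted_rpow, ENNReal.ofReal_mul (by positivity),
      ← ENNReal.ofReal_rpow_of_nonneg (norm_nonneg _) q.coe_nonneg, ofReal_norm]
  have h2 : ∀ (C : ℝ) (f : FockSpace n α p),
      ENNReal.ofReal (C * ‖f‖ ^ (q : ℝ)) = C.toNNReal * ‖f‖ₑ ^ (q : ℝ) := fun C f => by
    rw [ENNReal.ofReal_mul' (by positivity),
      ← ENNReal.ofReal_rpow_of_nonneg (norm_nonneg _) q.coe_nonneg, ofReal_norm]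
    rfl
  constructor
  · rintro ⟨C, hC⟩
    exact ⟨C.toNNReal, fun f => by rw [← h1, ← h2]; exact hC f⟩
  · rintro ⟨C, hC⟩
    exact ⟨C, fun f => by rw [h1, h2, Real.toNNReal_coe]; exact hC f⟩

theorem UnitBallBound.isFockCarleson (hpq : p ≤ q) {μ : Measure (CSpace n)} {M : ℝ≥0}
    (hM : UnitBallBound μ M) : IsFockCarleson α p q μ := by
  obtain ⟨C, hC⟩ := exists_lintegral_weighted_rpow_le n α p hpq
  exact isFockCarleson_iff.2 ⟨C * M, fun f => by simpa using hC μ M hM f⟩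

theorem UnitBallBound.toeplitzBounded {μ : Measure (CSpace n)} {M : ℝ≥0}
    (hM : UnitBallBound μ M) : ToeplitzBounded α p μ := by
  obtain ⟨J, hJ⟩ := hM.exists_isEmbedding (α := α) (le_refl p)
  obtain ⟨P, hP⟩ := hM.exists_isToeplitz_comp hJ
  exact ⟨_, hP⟩

/-- If `T_μ` is compact, then `T_μ k_a` tends to `0` in norm, since it does so pointwise. -/
theorem IsToeplitz.tendsto_measure_ball {μ : Measure (CSpace n)} (hμ : Admissible α μ)
    {T : FockSpace n α p →L[ℂ] GrowthFockSpace n α} (hT : IsToeplitz μ T)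
    (hc : IsCompactOperator T) : Tendsto (fun a => μ (ball a 1)) (cocompact _) (𝓝 0) := by
  have hα : 0 < α := Fact.out
  have hM := hT.unitBallBound hμ
  obtain ⟨C, hC⟩ := exists_lintegral_gaussian_le n (by positivity : 0 < α / 4)
  have hpt : ∀ z, Tendsto (fun a => ‖weighted α (T (coherentState α p a)) z‖ₑ)
      (cocompact (CSpace n)) (𝓝 0) := by
    intro z
    set D := ∫⁻ w, ENNReal.ofReal (Real.exp (-(α / 4) * ‖w - z‖ ^ 2)) ∂μ
    have hD : D ≠ ∞ :=
      ((hC μ _ hM z).trans_lt (ENNReal.mul_lt_top ENNReal.coe_lt_top ENNReal.coe_lt_top)).ne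
    have hlim : Tendsto (fun a => ENNReal.ofReal (Real.exp (-(α / 8) * ‖z - a‖ ^ 2)) * D)
        (cocompact (CSpace n)) (𝓝 0) := by
      have h1 := ENNReal.tendsto_ofReal
        (tendsto_exp_neg_mul_sq_sub (by positivity : 0 < α / 8) z)
      have h2 := ENNReal.Tendsto.mul_const h1 (Or.inr hD)
      simpa using h2
    refine tendsto_of_tendsto_of_tendsto_of_le_of_le tendsto_const_nhds hlim (fun _ => zero_le)
      fun a => ?_
    have h1 : (T (coherentState α p a) : CSpace n → ℂ) = toeplitz α μ (coherentFun α a) :=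
      funext fun z => hT (coherentState α p a) (hμ.inToeplitzDomain_coherentFun a) z
    change ‖weighted α (T (coherentState α p a)) z‖ₑ ≤ _
    rw [h1]
    refine (enorm_weighted_toeplitz_le _ _ _).trans ?_
    rw [← lintegral_const_mul _ (by fun_prop)]
    refine lintegral_mono fun w => ?_
    simp only [enorm_weighted_coherentFun]
    rw [← ENNReal.ofReal_mul (Real.exp_pos _).le, ← ENNReal.ofReal_mul (Real.exp_pos _).le,
      ← Real.exp_add, ← Real.exp_add]
    refine ENNReal.ofReal_le_ofReal (Real.exp_le_exp.2 ?_)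
    have h2 : ‖z - a‖ ≤ ‖w - a‖ + ‖w - z‖ := by
      have := norm_add_le (z - w) (w - a)
      rw [sub_add_sub_cancel, norm_sub_rev z w] at this
      linarith
    -- Half of each exponent gives the decay in `|z - a|`; the rest still dominates `e^{-α|w-z|²/4}`.
    have h3 : ‖z - a‖ ^ 2 ≤ 2 * ‖w - a‖ ^ 2 + 2 * ‖w - z‖ ^ 2 := by
      nlinarith [norm_nonneg (z - a), sq_nonneg (‖w - a‖ - ‖w - z‖)]
    have h4 : 0 ≤ α * ‖w - a‖ ^ 2 := by positivity
    nlinarith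
  have hlim : Tendsto (fun a => T (coherentState α p a)) (cocompact (CSpace n)) (𝓝 0) := by
    have := isCountablyGenerated_cocompact (n := n)
    refine tendsto_zero_of_isCompactOperator hc (C := ‖coherentState α p (0 : CSpace n)‖)
      (fun a => (congrArg NNReal.toReal (nnnorm_coherentState a)).le) fun u y hu hy => ?_
    refine norm_le_zero_iff.1 (GrowthFockSpace.norm_le le_rfl fun z => ?_)
    have h1 : Tendsto (fun i => weighted α (T (coherentState α p (u i))) z) atTop
        (𝓝 (weighted α y z)) := by
      rw [tendsto_iff_norm_sub_tendsto_zero]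
      refine squeeze_zero (fun _ => norm_nonneg _) (fun i => ?_)
        (tendsto_iff_norm_sub_tendsto_zero.1 hy)
      refine le_trans (le_of_eq ?_) (GrowthFockSpace.norm_weighted_le _ z)
      change _ = ‖((T (coherentState α p (u i))) z - y z) * _‖
      rw [sub_mul]
      rfl
    have h2 := tendsto_nhds_unique h1.enorm ((hpt z).comp hu)
    rw [enorm_eq_zero] at h2
    rw [h2, norm_zero]
  refine Fock.tendsto_measure_ball hα.le ?_
  have h1 := hlim.enorm
  rw [enorm_zero] at h1
  exact tendsto_of_tendsto_of_tendsto_of_le_of_le tendsto_const_nhds h1 (fun _ => zero_le)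
    fun a => hT.lintegral_gaussian_le hμ a

theorem UnitBallBound.isVanishingFockCarleson [Fact (1 ≤ q)] (hpq : p ≤ q)
    {μ : Measure (CSpace n)} {M : ℝ≥0} (hM : UnitBallBound μ M)
    (hV : Tendsto (fun a => μ (ball a 1)) (cocompact _) (𝓝 0)) :
    IsVanishingFockCarleson α p q μ := by
  obtain ⟨J, hJ⟩ := hM.exists_isEmbedding (α := α) hpq
  exact ⟨J, hJ, isCompactOperator_of_tendsto_measure_ball hpq hM hV hJ⟩

end Fock

end

theorem theorem2p1 (n : ℕ) (α : ℝ) [Fact (0 < α)] (p : ℝ≥0) [Fact (1 ≤ p)] :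
    (∀ μ : Measure (CSpace n), Fock.Admissible α μ →
      List.TFAE [
        Fock.ToeplitzBounded α p μ,
        ∃ q : ℝ≥0, p ≤ q ∧ Fock.IsFockCarleson α 1 q μ,
        ∀ q : ℝ≥0, p ≤ q → Fock.IsFockCarleson α 1 q μ] ∧
      (Fock.ToeplitzBounded α p μ → ∀ f : FockSpace n α p, Fock.InToeplitzDomain α μ f) ∧
      List.TFAE [
        Fock.ToeplitzCompact α p μ,
        ∃ (q : ℝ≥0) (_ : Fact (1 ≤ q)), p ≤ q ∧ Fock.IsVanishingFockCarleson α 1 q μ,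
        ∀ (q : ℝ≥0) [Fact (1 ≤ q)], p ≤ q → Fock.IsVanishingFockCarleson α 1 q μ]) ∧
    ∃ C : ℝ, 0 < C ∧ ∀ μ : Measure (CSpace n), Fock.Admissible α μ →
      (Fock.ToeplitzBounded α p μ ↔
        ∃ J : FockSpace n α 1 →L[ℂ] Lp ℂ (1 : ℝ≥0) (Fock.sigma α 1 μ), Fock.IsEmbedding μ J) ∧
      ∀ (T : FockSpace n α p →L[ℂ] GrowthFockSpace n α)
        (J : FockSpace n α 1 →L[ℂ] Lp ℂ (1 : ℝ≥0) (Fock.sigma α 1 μ)),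
        Fock.IsToeplitz μ T → Fock.IsEmbedding μ J → ‖T‖ ≤ C * ‖J‖ ∧ ‖J‖ ≤ C * ‖T‖ := by
  have hp : 1 ≤ p := Fact.out
  obtain ⟨C₁, h₁⟩ := Fock.exists_toeplitz_bound n α p
  refine ⟨fun μ hμ => ⟨?_, ?_, ?_⟩, ?_⟩
  · tfae_have 1 → 3 := by
      rintro ⟨T, hT⟩ q hq
      exact (hT.unitBallBound hμ).isFockCarleson (hp.trans hq)
    tfae_have 3 → 2 := fun h => ⟨p, le_rfl, h p le_rfl⟩
    tfae_have 2 → 1 := by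
      rintro ⟨q, -, h⟩
      obtain ⟨C, hC⟩ := Fock.isFockCarleson_iff.1 h
      exact (Fock.unitBallBound_of_carleson hC).toeplitzBounded
    tfae_finish
  · rintro ⟨T, hT⟩
    exact (h₁ μ _ (hT.unitBallBound hμ)).1
  · tfae_have 1 → 3 := by
      rintro ⟨T, hT, hc⟩ q _ hq
      exact (hT.unitBallBound hμ).isVanishingFockCarleson (hp.trans hq)
        (hT.tendsto_measure_ball hμ hc)
    tfae_have 3 → 2 := fun h => ⟨p, inferInstance, le_rfl, h p le_rfl⟩
    tfae_have 2 → 1 := by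
      rintro ⟨q, _, -, J, hJ, hc⟩
      have hM := Fock.unitBallBound_of_carleson hJ.carleson
      obtain ⟨J', hJ', hc'⟩ := hM.isVanishingFockCarleson (α := α) (le_refl p)
        (Fock.tendsto_measure_ball_of_isCompactOperator hJ hc)
      obtain ⟨P, hP⟩ := hM.exists_isToeplitz_comp hJ'
      exact ⟨_, hP, hc'.clm_comp P⟩
    tfae_finish
  · obtain ⟨C₂, h₂⟩ := Fock.exists_lintegral_weighted_rpow_le n α 1 (le_refl 1)
    set A : ℝ≥0 := C₁ * (Real.toNNReal (Real.exp (α / 2)) *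
      ‖Fock.coherentState α 1 (0 : CSpace n)‖₊)
    set B : ℝ≥0 := C₂ * (Real.toNNReal (Real.exp α) *
      ‖Fock.coherentState α p (0 : CSpace n)‖₊)
    refine ⟨A + B + 1, by positivity, fun μ hμ => ⟨⟨?_, ?_⟩, fun T J hT hJ => ⟨?_, ?_⟩⟩⟩
    · rintro ⟨T, hT⟩
      exact (hT.unitBallBound hμ).exists_isEmbedding le_rfl
    · rintro ⟨J, hJ⟩
      exact (Fock.unitBallBound_of_carleson hJ.carleson).toeplitzBounded
    · have hM := Fock.unitBallBound_of_carleson hJ.carleson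
      obtain ⟨hdom, hbd⟩ := h₁ μ _ hM
      have hTA : ‖T‖ ≤ A * ‖J‖ := by
        refine T.opNorm_le_bound (by positivity) fun f =>
          GrowthFockSpace.norm_le (by positivity) fun z => ?_
        have hTf : (T f : CSpace n → ℂ) = Fock.toeplitz α μ f := funext fun z => hT f (hdom f) z
        rw [hTf]
        refine (hbd f z).trans_eq ?_
        simp only [A, NNReal.coe_mul, NNReal.coe_one, mul_one, NNReal.rpow_one, coe_nnnorm]
        ring
      refine hTA.trans ?_
      gcongr
      linarith [B.coe_nonneg]
    · have hM := hT.unitBallBound hμ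
      have hJB : ‖J‖ ≤ B * ‖T‖ := by
        refine J.opNorm_le_bound (by positivity) fun f => ?_
        have h := h₂ μ _ hM f
        rw [← hJ.enorm_rpow, NNReal.coe_one, ENNReal.rpow_one, ENNReal.rpow_one, enorm_eq_nnnorm,
          enorm_eq_nnnorm] at h
        have h' : ‖J f‖₊ ≤ B * ‖T‖₊ * ‖f‖₊ := by
          refine le_trans (by exact_mod_cast h) (le_of_eq ?_)
          simp only [B]
          ring
        exact_mod_cast h'
      refine hJB.trans ?_
      gcongr
      linarith [A.coe_nonneg]
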